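/- Let $f:\mathbb{R}^n\to\mathbb{R}$ be $C^2$ in a neighbourhood of a critical point $\bar x$ which is nondegenerate (the Hessian of $f$ at $\bar x$ is invertible) and has Morse index $1$ (the maximal dimension of a subspace on which this Hessian is negative definite is $1$). For $\theta>0$ let $U=\{x:|x-\bar x|<\theta\}$, and for $c\in\mathbb{R}$ let $\mathrm{lev}_{\le c}f=\{x: f(x)\le c\}$. Components are path components. The fast local level set algorithm on $U$, started at a pair of points $x_0,y_0\in U$ with $f(x_0)=f(y_0)$, is the following. Given $(x_i,y_i)$, stop if $x_i=y_i$, and in that case put $\tilde x_j=\tilde y_j=x_i$ for all $j\ge i$. Otherwise: (1a) let $(\tilde x_i,\tilde y_i)$ be a minimizer of $|x-y|$ over all $x$ in the component of $x_i$ and all $y$ in the component of $y_i$ in $(\mathrm{lev}_{\le f(x_i)}f)\cap U$; (1b) let $z_i$ be a minimizer of $f$ on $L_i\cap U$, where $L_i$ is the affine space orthogonal to $\tilde x_i-\tilde y_i$ passing through $\tfrac12(\tilde x_i+\tilde y_i)$; (2) let $x_{i+1}$ be the point of the segment $[\tilde x_i,z_i]$ furthest away from $\tilde x_i$ such that $f\le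 f(z_i)$ on $[\tilde x_i,x_{i+1}]$, and let $y_{i+1}$ be the point of $[\tilde y_i,z_i]$ furthest away from $\tilde y_i$ such that $f\le f(z_i)$ on $[\tilde y_i,y_{i+1}]$; continue with $(x_{i+1},y_{i+1})$. Say that a sequence $(a_i)$ in a normed space converges superlinearly to $l$ if $a_i\to l$ and $|a_{i+1}-l|\le c_i|a_i-l|$ for all large $i$ with some $c_i\to0$. Then for every sufficiently small $\theta>0$ there is $\epsilon>0$ (depending on $\theta$) such that for all $x_0,y_0\in U$ with (a) $x_0$ and $y_0$ in different components of $(\mathrm{lev}_{\le f(x_0)}f)\cap U$, and (b) $f(\bar x)-\epsilon<f(x_0)=f(y_0)<f(\bar x)$, the algorithm can be carried out: as long as $x_i\ne y_i$, whatever minimizers were chosen before, all points required in (1a), (1b) and (2) exist. Moreover, for every run of the algorithm, all $\tilde x_i$ and $\tilde y_i$ lie in $U$, the values $f(\tilde x_i)$ and $f(\tilde y_i)$ converge superlinearly to $f(\bar x)$, and the iterates $\tilde x_i$ and $\tilde y_i$ converge superlinearly to $\bar x$. -/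

import Mathlib

open Filter Topology Asymptotics

noncomputable section

/-- The Hessian of `f` at `x`, as a bilinear form. -/
def hessian {n : ℕ} (f : EuclideanSpace ℝ (Fin n) → ℝ) (x : EuclideanSpace ℝ (Fin n)) :
    EuclideanSpace ℝ (Fin n) →L[ℝ] EuclideanSpace ℝ (Fin n) →L[ℝ] ℝ :=
  fderiv ℝ (fderiv ℝ f) x

/-- `x` is a critical point of `f` whose Hessian is invertible. -/
structure IsNondegenerateCriticalPoint {n : ℕ} (f : EuclideanSpace ℝ (Fin n) → ℝ)
    (x : EuclideanSpace ℝ (Fin n)) : Prop where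
  differentiableAt : DifferentiableAt ℝ f x
  fderiv_eq_zero : fderiv ℝ f x = 0
  hessian_invertible : Function.Bijective (hessian f x)

/-- The Morse index of `f` at `x` is `k`: the maximal dimension of a linear subspace on which the
Hessian is negative definite is `k`. -/
def HasMorseIndex {n : ℕ} (f : EuclideanSpace ℝ (Fin n) → ℝ) (x : EuclideanSpace ℝ (Fin n))
    (k : ℕ) : Prop :=
  IsGreatest {d : ℕ | ∃ W : Submodule ℝ (EuclideanSpace ℝ (Fin n)),
    Module.finrank ℝ W = d ∧ ∀ w ∈ W, w ≠ 0 → hessian f x w w < 0} k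

/-- The part `(lev_{≤ c} f) ∩ U` of a sublevel set of `f`. -/
def levelSetIn {n : ℕ} (f : EuclideanSpace ℝ (Fin n) → ℝ) (U : Set (EuclideanSpace ℝ (Fin n)))
    (c : ℝ) : Set (EuclideanSpace ℝ (Fin n)) :=
  {p | f p ≤ c} ∩ U

/-- Step 1(a): `(x', y')` minimizes `|p - q|` over all `p` in the (path) component of `x` and all
`q` in the (path) component of `y` in `(lev_{≤ f x} f) ∩ U`. -/
structure IsClosestPair {n : ℕ} (f : EuclideanSpace ℝ (Fin n) → ℝ)
    (U : Set (EuclideanSpace ℝ (Fin n))) (x y x' y' : EuclideanSpace ℝ (Fin n)) : Prop where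
  mem_left : x' ∈ pathComponentIn (levelSetIn f U (f x)) x
  mem_right : y' ∈ pathComponentIn (levelSetIn f U (f x)) y
  dist_le : ∀ p ∈ pathComponentIn (levelSetIn f U (f x)) x,
    ∀ q ∈ pathComponentIn (levelSetIn f U (f x)) y, dist x' y' ≤ dist p q

/-- Step 1(b): `z` minimizes `f` on `L ∩ U`, where `L` is the affine space orthogonal to `x - y`
passing through the midpoint of `x` and `y`. -/
structure IsBisectorMinimizer {n : ℕ} (f : EuclideanSpace ℝ (Fin n) → ℝ)
    (U : Set (EuclideanSpace ℝ (Fin n))) (x y z : EuclideanSpace ℝ (Fin n)) : Prop where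
  mem_bisector : z ∈ AffineSubspace.perpBisector x y
  mem : z ∈ U
  le : ∀ w ∈ AffineSubspace.perpBisector x y, w ∈ U → f z ≤ f w

/-- Step 2: `x'` is the point of the segment `[x, z]` furthest away from `x` such that
`f ≤ f z` on the segment `[x, x']`. -/
structure IsFurthestPoint {n : ℕ} (f : EuclideanSpace ℝ (Fin n) → ℝ)
    (x z x' : EuclideanSpace ℝ (Fin n)) : Prop where
  mem_segment : x' ∈ segment ℝ x z
  le : ∀ p ∈ segment ℝ x x', f p ≤ f z
  dist_le : ∀ w ∈ segment ℝ x z, (∀ p ∈ segment ℝ x w, f p ≤ f z) → dist x w ≤ dist x x'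

/-- One pass of the fast local level set algorithm: from the pair `(x, y)` it computes the closest
pair `(xt, yt)`, then `z`, and then the next pair `(x', y')`. -/
structure IsLevelSetStep {n : ℕ} (f : EuclideanSpace ℝ (Fin n) → ℝ)
    (U : Set (EuclideanSpace ℝ (Fin n)))
    (x y xt yt z x' y' : EuclideanSpace ℝ (Fin n)) : Prop where
  closest : IsClosestPair f U x y xt yt
  bisector : IsBisectorMinimizer f U xt yt z
  next_left : IsFurthestPoint f xt z x'
  next_right : IsFurthestPoint f yt z y'

/-- The pairs that the algorithm, started at `(x₀, y₀)`, can reach after finitely many passes;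
it stops as soon as the two points of the current pair coincide. -/
inductive LevelSetReachable {n : ℕ} (f : EuclideanSpace ℝ (Fin n) → ℝ)
    (U : Set (EuclideanSpace ℝ (Fin n))) (x₀ y₀ : EuclideanSpace ℝ (Fin n)) :
    EuclideanSpace ℝ (Fin n) → EuclideanSpace ℝ (Fin n) → Prop
  | init : LevelSetReachable f U x₀ y₀ x₀ y₀
  | step {x y xt yt z x' y' : EuclideanSpace ℝ (Fin n)} :
      LevelSetReachable f U x₀ y₀ x y → x ≠ y → IsLevelSetStep f U x y xt yt z x' y' →
      LevelSetReachable f U x₀ y₀ x' y'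

/-- `x`, `y`, `xt`, `yt`, `z` are the sequences of a complete run of the algorithm started at
`(x₀, y₀)`. If `x i = y i`, the algorithm stops and all sequences stay at this point. -/
structure IsLevelSetRun {n : ℕ} (f : EuclideanSpace ℝ (Fin n) → ℝ)
    (U : Set (EuclideanSpace ℝ (Fin n))) (x₀ y₀ : EuclideanSpace ℝ (Fin n))
    (x y xt yt z : ℕ → EuclideanSpace ℝ (Fin n)) : Prop where
  init_left : x 0 = x₀
  init_right : y 0 = y₀
  step : ∀ i, x i ≠ y i →
    IsLevelSetStep f U (x i) (y i) (xt i) (yt i) (z i) (x (i + 1)) (y (i + 1))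
  halt : ∀ i, x i = y i →
    xt i = x i ∧ yt i = x i ∧ z i = x i ∧ x (i + 1) = x i ∧ y (i + 1) = x i

/-- The sequence `a` converges (Q-)superlinearly to `l`: it converges to `l` and
`‖a (i + 1) - l‖ ≤ c i * ‖a i - l‖` for some `c i → 0`. -/
def ConvergesSuperlinearly {E : Type*} [NormedAddCommGroup E] (a : ℕ → E) (l : E) : Prop :=
  Tendsto a atTop (𝓝 l) ∧ (fun i => a (i + 1) - l) =o[atTop] (fun i => a i - l)

end

/-! Write a point as `c + t • e + v`, with `e` the unit eigenvector of the negative eigenvalue `-a`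
of the Hessian at the saddle `c` and `v` orthogonal to `e`. Near `c`, `f - f c` is `(H v v - a t²) /
2` up to a small relative error, and `H` is positive definite on the `v`.

Topology. A point below level `f c` has `t ≠ 0`, so a sublevel set in the ball splits by the sign of
`t`. Each side is path connected: shrink `v` until the point lies in a narrow cone around the axis,
then push outwards along the axis; neither motion raises `f`. Thus the components in the algorithm
are the two sides (`pathComponentIn_eq_positivePart`).

One pass. Write the level as `f c - a σ² / 2`. Two axis points near `c ± σ • e` bound the distance
of the sides from above, and the lower quadratic bound then forces the closest pair to lie within
relative error `k` of `c ± σ • e` (`axis_coord_bounds`). So the bisector is almost orthogonal to the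
axis and almost passes through `c`, and on it `f ≥ f c - 96 a k² σ²` (`SaddleModel.bisector_lower`).
The gap `f c - f x` is therefore multiplied by at most `192 k²` (`SaddlePair.gap_le`).

Rate. With one fixed `k` the gap at least halves, so it tends to `0`. Any smaller `k` is admissible
on a smaller ball, which the pairs eventually enter; hence the gap decays superlinearly. Since the
gap is comparable to the squared distance of the closest points to `c` (`SaddlePair.norm_bounds`),
the iterates converge superlinearly too. If a bisector minimizer reaches level `f c`, it is `c`
itself and the algorithm stops there (`SaddlePair.step`). -/

noncomputable section

/-! ### Spectral form of the Hessian and Taylor estimates -/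

section NormalForm

variable {E : Type*} [NormedAddCommGroup E] [InnerProductSpace ℝ E]

/-- A symmetric nondegenerate bilinear form of negative index one has a unit eigenvector with a
negative eigenvalue, and is positive definite on the orthogonal complement. -/
theorem exists_negative_axis [FiniteDimensional ℝ E] (H : E →L[ℝ] E →L[ℝ] ℝ) (hsymm : ∀ u v, H u v = H v u)
    (hinj : Function.Injective H)
    (hindex : IsGreatest {d : ℕ | ∃ W : Submodule ℝ E,
      Module.finrank ℝ W = d ∧ ∀ w ∈ W, w ≠ 0 → H w w < 0} 1) :
    ∃ (e : E) (a b : ℝ), ‖e‖ = 1 ∧ 0 < a ∧ 0 < b ∧ (∀ u, H u e = -a * inner ℝ e u) ∧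
      ∀ v, inner ℝ e v = 0 → b * ‖v‖ ^ 2 ≤ H v v := by
  -- The Riesz representative of `H` is self-adjoint, so the spectral theorem diagonalizes `H` in an
  -- orthonormal basis.
  let T : E →ₗ[ℝ] E :=
    { toFun := fun u => (InnerProductSpace.toDual ℝ E).symm (H u)
      map_add' := by intro u v; simp
      map_smul' := by intro r u; simp }
  have hTH : ∀ u v, inner ℝ (T u) v = H u v := fun u v =>
    InnerProductSpace.toDual_symm_apply
  have hT : T.IsSymmetric := by
    intro u v
    rw [hTH, real_inner_comm, hTH, hsymm]
  let B := hT.eigenvectorBasis rfl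
  let l := hT.eigenvalues rfl
  have hB : ∀ i u, H (B i) u = l i * inner ℝ (B i) u := by
    intro i u
    rw [← hTH, hT.apply_eigenvectorBasis rfl i, inner_smul_left]
    rfl
  have hexp : ∀ v, H v v = ∑ i, l i * inner ℝ (B i) v ^ 2 := by
    intro v
    rw [← hTH, ← B.sum_inner_mul_inner]
    refine Finset.sum_congr rfl fun i _ => ?_
    rw [hTH, hsymm, hB]; ring
  have hne : ∀ i, l i ≠ 0 := by
    intro i hi
    have h0 : B i = 0 := hinj (by ext u; simp [hB, hi])
    have := B.norm_eq_one i
    simp [h0] at this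
  obtain ⟨W, hW1, hW⟩ := hindex.1
  obtain ⟨w, hw⟩ : ∃ w : W, w ≠ 0 := by
    have : Nontrivial W := Module.nontrivial_of_finrank_pos (R := ℝ) (by omega)
    exact exists_ne 0
  have hwneg := hW w w.2 (by simpa using hw)
  obtain ⟨i, hi⟩ : ∃ i, l i < 0 := by
    by_contra! h
    rw [hexp] at hwneg
    exact absurd hwneg (not_lt.2 (Finset.sum_nonneg fun i _ => mul_nonneg (h i) (sq_nonneg _)))
  -- A second negative eigenvalue would give a negative definite plane, against index one.
  have hpos : ∀ j, j ≠ i → 0 < l j := by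
    intro j hj
    by_contra! hlj
    have hlj : l j < 0 := lt_of_le_of_ne hlj (hne j)
    have hli : LinearIndependent ℝ (fun k : Fin 2 => B (![i, j] k)) := by
      refine B.orthonormal.linearIndependent.comp ![i, j] ?_
      intro p q hpq
      fin_cases p <;> fin_cases q <;> simp_all
    have h2 := hindex.2 ⟨Submodule.span ℝ (Set.range fun k : Fin 2 => B (![i, j] k)), by
      simpa using finrank_span_eq_card hli, ?_⟩
    · omega
    · intro w hw hw0
      obtain ⟨g, rfl⟩ := (Submodule.mem_span_range_iff_exists_fun ℝ).1 hw
      have hij : inner ℝ (B i) (B j) = 0 := B.orthonormal.2 hj.symm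
      have hji : inner ℝ (B j) (B i) = 0 := B.orthonormal.2 hj
      have hval : H (∑ k, g k • B (![i, j] k)) (∑ k, g k • B (![i, j] k)) =
          l i * g 0 ^ 2 + l j * g 1 ^ 2 := by
        simp [Fin.sum_univ_two, hB, inner_add_right, inner_smul_right, hij, hji]
        ring
      rw [hval]
      by_cases h0 : g 0 = 0
      · have h1 : g 1 ≠ 0 := by
          intro h1
          exact hw0 (by simp [Fin.sum_univ_two, h0, h1])
        rw [h0]
        nlinarith [mul_neg_of_neg_of_pos hlj (by positivity : 0 < g 1 ^ 2)]
      · nlinarith [mul_neg_of_neg_of_pos hi (by positivity : 0 < g 0 ^ 2),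
          mul_nonpos_of_nonpos_of_nonneg hlj.le (sq_nonneg (g 1))]
  obtain ⟨j, -, hj⟩ := Finset.exists_min_image Finset.univ (fun j => |l j|) ⟨i, Finset.mem_univ i⟩
  refine ⟨B i, -l i, |l j|, B.norm_eq_one i, by linarith, abs_pos.2 (hne j), ?_, ?_⟩
  · intro u
    rw [hsymm, hB]; ring
  · intro v hv
    rw [hexp, ← B.sum_sq_norm_inner_right v, Finset.mul_sum]
    refine Finset.sum_le_sum fun k _ => ?_
    rw [Real.norm_eq_abs, sq_abs]
    by_cases hk : k = i
    · simp [hk, hv]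
    · have := hj k (Finset.mem_univ k)
      rw [abs_of_pos (hpos k hk)] at this
      exact mul_le_mul_of_nonneg_right this (sq_nonneg _)

/-- First and second order Taylor estimates at a critical point. -/
theorem exists_taylor_bounds {f : E → ℝ} {c : E} (hf : ContDiffAt ℝ 2 f c)
    (hc : fderiv ℝ f c = 0) {δ : ℝ} (hδ : 0 < δ) :
    ∃ r > 0, ∀ x ∈ Metric.ball c r, DifferentiableAt ℝ f x ∧
      ‖fderiv ℝ f x - fderiv ℝ (fderiv ℝ f) c (x - c)‖ ≤ δ * ‖x - c‖ ∧
      |f x - f c - fderiv ℝ (fderiv ℝ f) c (x - c) (x - c) / 2| ≤ δ * ‖x - c‖ ^ 2 := by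
  set H := fderiv ℝ (fderiv ℝ f) c with hH
  have hsymm : ∀ u v, H u v = H v u := fun u v => by
    have := hf.isSymmSndFDerivAt (by simp)
    exact this u v
  have h1 : DifferentiableAt ℝ (fderiv ℝ f) c :=
    (hf.fderiv_right (m := 1) (by norm_num)).differentiableAt (by norm_num)
  have h2 := h1.hasFDerivAt.isLittleO.def hδ
  have h3 : ∀ᶠ x in 𝓝 c, DifferentiableAt ℝ f x :=
    (hf.eventually (by simp)).mono fun x hx => hx.differentiableAt (by norm_num)
  obtain ⟨r, hr, h⟩ := Metric.eventually_nhds_iff_ball.1 (h2.and h3)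
  refine ⟨r, hr, fun x hx => ?_⟩
  have hD : ∀ y ∈ Metric.ball c r, ‖fderiv ℝ f y - H (y - c)‖ ≤ δ * ‖y - c‖ := by
    intro y hy
    simpa [hc] using (h y hy).1
  refine ⟨(h x hx).2, hD x hx, ?_⟩
  have hsub : ∀ y ∈ Metric.closedBall c ‖x - c‖, y ∈ Metric.ball c r := by
    intro y hy
    rw [Metric.mem_closedBall] at hy
    rw [Metric.mem_ball, dist_eq_norm] at hx
    exact lt_of_le_of_lt hy hx
  have hder : ∀ y ∈ Metric.closedBall c ‖x - c‖,
      HasFDerivWithinAt (fun y => f y - H (y - c) (y - c) / 2)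
        (fderiv ℝ f y - H (y - c)) (Metric.closedBall c ‖x - c‖) y := by
    intro y hy
    have hi : HasFDerivAt (fun y : E => y - c) (ContinuousLinearMap.id ℝ E) y :=
      (hasFDerivAt_id y).sub_const c
    have hq := ((H.hasFDerivAt.comp y hi).clm_apply hi).mul_const (1 / 2 : ℝ)
    have := ((h y (hsub y hy)).2.hasFDerivAt.sub hq).hasFDerivWithinAt
      (s := Metric.closedBall c ‖x - c‖)
    have e1 : (f - fun y => (H (y - c)) (y - c) * (1 / 2)) =
        fun y => f y - H (y - c) (y - c) / 2 := by
      ext z; simp; ring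
    have e2 : fderiv ℝ f y - (1 / 2 : ℝ) • ((H (y - c)).comp (ContinuousLinearMap.id ℝ E) +
        (H.comp (ContinuousLinearMap.id ℝ E)).flip (y - c)) = fderiv ℝ f y - H (y - c) := by
      ext z
      simp [hsymm z]
      ring
    rw [← e1, ← e2]
    exact this
  -- The second order estimate is the mean value inequality for `f` minus its quadratic part, whose
  -- derivative is at most `δ * ‖x - c‖` on this ball.
  have hmv := (convex_closedBall c ‖x - c‖).norm_image_sub_le_of_norm_hasFDerivWithin_le
    (C := δ * ‖x - c‖) hder (fun y hy => (hD y (hsub y hy)).trans (by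
      rw [Metric.mem_closedBall, dist_eq_norm] at hy
      gcongr)) (Metric.mem_closedBall_self (norm_nonneg _))
    (show x ∈ Metric.closedBall c ‖x - c‖ by simp [dist_eq_norm])
  rw [Real.norm_eq_abs] at hmv
  convert hmv using 1
  · congr 1; simp; ring
  · ring

end NormalForm

/-! ### Axial and orthogonal coordinates at the saddle -/

section Coordinates

variable {E : Type*} [NormedAddCommGroup E] [InnerProductSpace ℝ E]

/-- The coordinate of `x` along the axis through `c` with direction `e`. -/
def axisCoord (e c x : E) : ℝ := inner ℝ e (x - c)

/-- The component of `x - c` orthogonal to `e`. -/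
def perpPart (e c x : E) : E := x - c - axisCoord e c x • e

@[simp] theorem axisCoord_self (e c : E) : axisCoord e c c = 0 := by simp [axisCoord]

@[simp] theorem perpPart_self (e c : E) : perpPart e c c = 0 := by simp [perpPart]

@[simp] theorem axisCoord_neg (e c x : E) : axisCoord (-e) c x = -axisCoord e c x := by
  simp [axisCoord]

@[simp] theorem perpPart_neg (e c x : E) : perpPart (-e) c x = perpPart e c x := by
  simp [perpPart]

theorem continuous_axisCoord (e c : E) : Continuous (axisCoord e c) := by
  unfold axisCoord; fun_prop

theorem axisCoord_smul_add_perpPart (e c x : E) :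
    axisCoord e c x • e + perpPart e c x = x - c := by
  simp [perpPart]

theorem add_axisCoord_add_perpPart (e c x : E) :
    c + axisCoord e c x • e + perpPart e c x = x := by
  simp [perpPart]

variable {e c : E}

theorem inner_perpPart (he : ‖e‖ = 1) (x : E) : inner ℝ e (perpPart e c x) = 0 := by
  simp [perpPart, inner_sub_right, inner_smul_right, he, axisCoord]

theorem axisCoord_add (he : ‖e‖ = 1) (τ : ℝ) {v : E} (hv : inner ℝ e v = 0) :
    axisCoord e c (c + τ • e + v) = τ := by
  simp [axisCoord, add_assoc, inner_add_right, inner_smul_right, he, hv]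

theorem perpPart_add (he : ‖e‖ = 1) (τ : ℝ) {v : E} (hv : inner ℝ e v = 0) :
    perpPart e c (c + τ • e + v) = v := by
  rw [perpPart, axisCoord_add he τ hv]; abel

theorem axisCoord_axis (he : ‖e‖ = 1) (τ : ℝ) : axisCoord e c (c + τ • e) = τ := by
  simpa using axisCoord_add (c := c) he τ (inner_zero_right e)

theorem perpPart_axis (he : ‖e‖ = 1) (τ : ℝ) : perpPart e c (c + τ • e) = 0 := by
  simpa using perpPart_add (c := c) he τ (inner_zero_right e)

theorem norm_sub_sq_eq_coord (he : ‖e‖ = 1) (x : E) :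
    ‖x - c‖ ^ 2 = axisCoord e c x ^ 2 + ‖perpPart e c x‖ ^ 2 := by
  conv_lhs => rw [← axisCoord_smul_add_perpPart e c x]
  rw [norm_add_sq_real, inner_smul_left, inner_perpPart he, norm_smul, he]
  simp

theorem mem_ball_iff_coord (he : ‖e‖ = 1) {x : E} {r : ℝ} (hr : 0 < r) :
    x ∈ Metric.ball c r ↔ axisCoord e c x ^ 2 + ‖perpPart e c x‖ ^ 2 < r ^ 2 := by
  rw [Metric.mem_ball, dist_eq_norm, ← norm_sub_sq_eq_coord he, sq_lt_sq₀ (norm_nonneg _) hr.le]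

theorem mem_closedBall_iff_coord (he : ‖e‖ = 1) {x : E} {r : ℝ} (hr : 0 < r) :
    x ∈ Metric.closedBall c r ↔ axisCoord e c x ^ 2 + ‖perpPart e c x‖ ^ 2 ≤ r ^ 2 := by
  rw [Metric.mem_closedBall, dist_eq_norm, ← norm_sub_sq_eq_coord he,
    sq_le_sq₀ (norm_nonneg _) hr.le]

theorem axisCoord_sub_le_dist (he : ‖e‖ = 1) (x y : E) :
    axisCoord e c x - axisCoord e c y ≤ dist x y := by
  have : axisCoord e c x - axisCoord e c y = inner ℝ e (x - y) := by
    simp [axisCoord, inner_sub_right]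
  rw [this, dist_eq_norm]
  simpa [he] using real_inner_le_norm e (x - y)

theorem dist_sq_eq_coord (he : ‖e‖ = 1) (x y : E) :
    dist x y ^ 2 = (axisCoord e c x - axisCoord e c y) ^ 2 +
      ‖perpPart e c x - perpPart e c y‖ ^ 2 := by
  have h : x - y = (axisCoord e c x - axisCoord e c y) • e +
      (perpPart e c x - perpPart e c y) := by
    rw [sub_smul, perpPart, perpPart]; abel
  rw [dist_eq_norm, h, norm_add_sq_real, inner_smul_left, inner_sub_right,
    inner_perpPart he, inner_perpPart he, norm_smul, he]
  simp

theorem mem_perpBisector_iff_coord (he : ‖e‖ = 1) {w p q : E} :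
    w ∈ AffineSubspace.perpBisector p q ↔
      2 * axisCoord e c w * (axisCoord e c p - axisCoord e c q) +
        2 * inner ℝ (perpPart e c w) (perpPart e c p - perpPart e c q) =
      axisCoord e c p ^ 2 + ‖perpPart e c p‖ ^ 2 -
        (axisCoord e c q ^ 2 + ‖perpPart e c q‖ ^ 2) := by
  rw [AffineSubspace.mem_perpBisector_iff_dist_eq, ← sq_eq_sq₀ dist_nonneg dist_nonneg,
    dist_sq_eq_coord (c := c) he, dist_sq_eq_coord (c := c) he, norm_sub_sq_real,
    norm_sub_sq_real, inner_sub_right]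
  constructor <;> intro h <;> linarith

end Coordinates

/-! ### Quadratic estimates for the closest pair and its bisector -/

section SaddleModel

variable {E : Type*} [NormedAddCommGroup E] [InnerProductSpace ℝ E]

/-- On the ball of radius `r` about `c`, the function `f` lies between two quadratic saddles with
axis `e`; the relative error along the axis is `η`, and `k` is a slope that controls all
deviations from the axis. -/
structure SaddleModel (f : E → ℝ) (c e : E) (a b B η k r : ℝ) : Prop where
  norm_axis : ‖e‖ = 1
  a_pos : 0 < a
  b_pos : 0 < b
  k_pos : 0 < k
  k_le : k ≤ 1 / 20
  k_small : 384 * a * k ^ 2 ≤ b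
  η_pos : 0 < η
  η_le : η ≤ k
  η_small : 20 * a * η ≤ b * k ^ 2
  r_pos : 0 < r
  lower : ∀ x ∈ Metric.ball c r,
    (b * ‖perpPart e c x‖ ^ 2 - a * (1 + η) * axisCoord e c x ^ 2) / 2 ≤ f x - f c
  upper : ∀ x ∈ Metric.ball c r,
    f x - f c ≤ (B * ‖perpPart e c x‖ ^ 2 - a * (1 - η) * axisCoord e c x ^ 2) / 2

/-- The points `p` and `q` are close to `c + σ • e` and `c - σ • e`, relative to `σ`. -/
structure NearAxisPair (e c : E) (k σ : ℝ) (p q : E) : Prop where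
  left_ge : (1 - 3 * k) * σ ≤ axisCoord e c p
  left_le : axisCoord e c p ≤ (1 + 3 * k) * σ
  right_ge : (1 - 3 * k) * σ ≤ -axisCoord e c q
  right_le : -axisCoord e c q ≤ (1 + 3 * k) * σ
  left_perp : ‖perpPart e c p‖ ≤ k * σ
  right_perp : ‖perpPart e c q‖ ≤ k * σ

variable {f : E → ℝ} {c e : E} {a b B η k r : ℝ}

/-- This symmetry lets every statement about the positive side be used for the negative side. -/
theorem SaddleModel.neg (h : SaddleModel f c e a b B η k r) :
    SaddleModel f c (-e) a b B η k r :=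
  { h with
    norm_axis := by simpa using h.norm_axis
    lower := by simpa using h.lower
    upper := by simpa using h.upper }

theorem SaddleModel.axis_le (h : SaddleModel f c e a b B η k r) {τ : ℝ} (hτ : |τ| < r) :
    f (c + τ • e) ≤ f c - a * (1 - η) * τ ^ 2 / 2 := by
  have := h.upper (c + τ • e) (by simpa [norm_smul, h.norm_axis] using hτ)
  rw [axisCoord_axis h.norm_axis, perpPart_axis h.norm_axis] at this
  simp at this
  linarith

/-- The axis points at height `σ * (1 + η)` lie in the sublevel set of level `f c - a σ² / 2`. -/
theorem SaddleModel.axis_le_level (h : SaddleModel f c e a b B η k r) {σ τ : ℝ} (hσ : 0 < σ)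
    (hτ : |τ| = σ * (1 + η)) (hr : 2 * σ < r) :
    f (c + τ • e) ≤ f c - a * σ ^ 2 / 2 := by
  have hη := h.η_pos
  have hη' := h.η_le
  have hk := h.k_le
  have h1 : |τ| < r := by rw [hτ]; nlinarith
  -- Going further out by the factor `1 + η` compensates the error factor `1 - η` of the upper
  -- bound.
  have h2 : 1 ≤ (1 - η) * (1 + η) ^ 2 := by nlinarith [mul_pos hη hη]
  have h3 : τ ^ 2 = σ ^ 2 * (1 + η) ^ 2 := by rw [← sq_abs, hτ]; ring
  have h4 := h.axis_le h1
  have h5 : a * σ ^ 2 * 1 ≤ a * σ ^ 2 * ((1 - η) * (1 + η) ^ 2) :=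
    mul_le_mul_of_nonneg_left h2 (by have := h.a_pos; positivity)
  rw [h3] at h4
  linarith

/-- Here `t` and `t'` are the heights of the two points on their sides and `n` is the distance of
the first from the axis. The level forces both heights to be at least `(1 - η) * σ`; as their sum is
at most `2 * σ * (1 + η)`, each is at most `(1 + 3 * η) * σ`. So little room is left in the level
inequality that `b * n ^ 2 ≤ 20 * a * η * σ ^ 2`, which is why `η` is required to be of order `k ^
2`. -/
theorem axis_coord_bounds {t t' n σ : ℝ} (ha : 0 < a) (hb : 0 < b) (hη : 0 < η) (hηk : η ≤ k)
    (hk : k ≤ 1 / 20) (hbk : 20 * a * η ≤ b * k ^ 2) (hσ : 0 < σ) (ht : 0 < t) (ht' : 0 < t')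
    (hn : 0 ≤ n) (h : b * n ^ 2 + a * σ ^ 2 ≤ a * (1 + η) * t ^ 2)
    (h' : a * σ ^ 2 ≤ a * (1 + η) * t' ^ 2) (hsum : t + t' ≤ 2 * σ * (1 + η)) :
    (1 - 3 * k) * σ ≤ t ∧ t ≤ (1 + 3 * k) * σ ∧ n ≤ k * σ := by
  have key : ∀ u, 0 < u → a * σ ^ 2 ≤ a * (1 + η) * u ^ 2 → (1 - η) * σ ≤ u := by
    intro u hu hau
    have h1 : σ ^ 2 ≤ (1 + η) * u ^ 2 := by
      rw [mul_assoc] at hau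
      exact le_of_mul_le_mul_left hau ha
    by_contra! hlt
    have h2 : u ^ 2 < ((1 - η) * σ) ^ 2 := pow_lt_pow_left₀ hlt hu.le two_ne_zero
    have h3 : (1 + η) * (1 - η) ^ 2 ≤ 1 := by nlinarith [mul_pos hη hη]
    have h4 : (1 + η) * u ^ 2 < (1 + η) * ((1 - η) * σ) ^ 2 := by gcongr
    nlinarith [mul_le_mul_of_nonneg_right h3 (sq_nonneg σ)]
  have hk0 : 0 < k := hη.trans_le hηk
  have h1 := key t ht (by nlinarith [mul_nonneg hb.le (sq_nonneg n)])
  have h2 := key t' ht' h'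
  have h3 : t ≤ (1 + 3 * η) * σ := by linarith
  refine ⟨by nlinarith, by nlinarith, ?_⟩
  have h4 : t ^ 2 ≤ ((1 + 3 * η) * σ) ^ 2 := by gcongr
  have h5 : (1 + η) * (1 + 3 * η) ^ 2 - 1 ≤ 20 * η := by nlinarith [mul_pos hη hη]
  have h6 : a * (1 + η) * t ^ 2 ≤ a * (1 + η) * ((1 + 3 * η) * σ) ^ 2 := by gcongr
  have h7 := mul_le_mul_of_nonneg_left h5 (by positivity : 0 ≤ a * σ ^ 2)
  have h8 := mul_le_mul_of_nonneg_right hbk (sq_nonneg σ)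
  have h9 : b * n ^ 2 ≤ b * (k * σ) ^ 2 := by nlinarith
  exact (sq_le_sq₀ hn (by positivity)).1 (le_of_mul_le_mul_left h9 hb)

theorem SaddleModel.nearAxisPair (h : SaddleModel f c e a b B η k r) {σ : ℝ} (hσ : 0 < σ)
    {p q : E} (hp : p ∈ Metric.ball c r) (hq : q ∈ Metric.ball c r)
    (htp : 0 < axisCoord e c p) (htq : axisCoord e c q < 0)
    (hfp : f p ≤ f c - a * σ ^ 2 / 2) (hfq : f q ≤ f c - a * σ ^ 2 / 2)
    (hd : dist p q ≤ 2 * σ * (1 + η)) : NearAxisPair e c k σ p q := by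
  have hlp := h.lower p hp
  have hlq := h.lower q hq
  have hs := (axisCoord_sub_le_dist (c := c) h.norm_axis p q).trans hd
  have hp' : b * ‖perpPart e c p‖ ^ 2 + a * σ ^ 2 ≤ a * (1 + η) * axisCoord e c p ^ 2 := by
    linarith
  have hq' : b * ‖perpPart e c q‖ ^ 2 + a * σ ^ 2 ≤ a * (1 + η) * (-axisCoord e c q) ^ 2 := by
    rw [neg_sq]; linarith
  have hbp := mul_nonneg h.b_pos.le (sq_nonneg ‖perpPart e c p‖)
  have hbq := mul_nonneg h.b_pos.le (sq_nonneg ‖perpPart e c q‖)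
  obtain ⟨h1, h2, h3⟩ := axis_coord_bounds h.a_pos h.b_pos h.η_pos h.η_le h.k_le h.η_small hσ htp
    (neg_pos.2 htq) (norm_nonneg _) hp' (by linarith) (by linarith)
  obtain ⟨h4, h5, h6⟩ := axis_coord_bounds h.a_pos h.b_pos h.η_pos h.η_le h.k_le h.η_small hσ
    (neg_pos.2 htq) htp (norm_nonneg _) hq' (by linarith) (by linarith)
  exact ⟨h1, h2, h4, h5, h3, h6⟩

/-- The bisector equation is solved for the height of `w`. The first term on the right is the offset
caused by the different distances of `p` and `q` from `c`, the second the tilt of the bisector. -/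
theorem NearAxisPair.mul_abs_axisCoord_le {σ : ℝ} {p q w : E} (h : NearAxisPair e c k σ p q)
    (he : ‖e‖ = 1) (hσ : 0 < σ) (hk' : k ≤ 1 / 20)
    (hw : w ∈ AffineSubspace.perpBisector p q) :
    σ * |axisCoord e c w| ≤ |axisCoord e c p ^ 2 + ‖perpPart e c p‖ ^ 2 -
        (axisCoord e c q ^ 2 + ‖perpPart e c q‖ ^ 2)| / 2 + 2 * k * σ * ‖perpPart e c w‖ := by
  rw [mem_perpBisector_iff_coord (c := c) he] at hw
  have hd : σ ≤ axisCoord e c p - axisCoord e c q := by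
    have := h.left_ge
    have := h.right_ge
    nlinarith
  have hin : |inner ℝ (perpPart e c w) (perpPart e c p - perpPart e c q)| ≤
      ‖perpPart e c w‖ * (2 * k * σ) := by
    refine (abs_real_inner_le_norm _ _).trans (mul_le_mul_of_nonneg_left ?_ (norm_nonneg _))
    refine (norm_sub_le _ _).trans ?_
    linarith [h.left_perp, h.right_perp]
  set D := axisCoord e c p ^ 2 + ‖perpPart e c p‖ ^ 2 -
    (axisCoord e c q ^ 2 + ‖perpPart e c q‖ ^ 2)
  set I := inner ℝ (perpPart e c w) (perpPart e c p - perpPart e c q)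
  have h1 : axisCoord e c w * (axisCoord e c p - axisCoord e c q) = D / 2 - I := by linarith
  calc σ * |axisCoord e c w| ≤ (axisCoord e c p - axisCoord e c q) * |axisCoord e c w| := by
        gcongr
    _ = |axisCoord e c w * (axisCoord e c p - axisCoord e c q)| := by
        rw [abs_mul, abs_of_pos (hσ.trans_le hd), mul_comm]
    _ ≤ |D / 2| + |I| := by rw [h1]; exact abs_sub _ _
    _ ≤ _ := by rw [abs_div, abs_two]; linarith

theorem NearAxisPair.abs_axisCoord_le {σ : ℝ} {p q w : E} (h : NearAxisPair e c k σ p q)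
    (he : ‖e‖ = 1) (hσ : 0 < σ) (hk : 0 < k) (hk' : k ≤ 1 / 20)
    (hw : w ∈ AffineSubspace.perpBisector p q) :
    |axisCoord e c w| ≤ 8 * k * (σ + ‖perpPart e c w‖) := by
  have h1 := h.mul_abs_axisCoord_le he hσ hk' hw
  -- The squared heights differ by at most `((1 + 3 * k) ^ 2 - (1 - 3 * k) ^ 2) * σ ^ 2 = 12 * k * σ
  -- ^ 2`; the orthogonal parts contribute only order `k ^ 2 * σ ^ 2`.
  have h2 : |axisCoord e c p ^ 2 + ‖perpPart e c p‖ ^ 2 -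
      (axisCoord e c q ^ 2 + ‖perpPart e c q‖ ^ 2)| ≤ 16 * k * σ ^ 2 := by
    have hp2 : ‖perpPart e c p‖ ^ 2 ≤ (k * σ) ^ 2 := by gcongr; exact h.left_perp
    have hq2 : ‖perpPart e c q‖ ^ 2 ≤ (k * σ) ^ 2 := by gcongr; exact h.right_perp
    have hks : (k * σ) ^ 2 ≤ k * σ ^ 2 / 20 := by
      nlinarith [mul_le_mul_of_nonneg_right hk' (by positivity : 0 ≤ k * σ ^ 2)]
    have hkk : k ^ 2 * σ ^ 2 ≤ k * σ ^ 2 / 20 := by linarith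
    have a1 : ((1 - 3 * k) * σ) ^ 2 ≤ axisCoord e c p ^ 2 :=
      pow_le_pow_left₀ (by nlinarith) h.left_ge 2
    have a2 : axisCoord e c p ^ 2 ≤ ((1 + 3 * k) * σ) ^ 2 :=
      pow_le_pow_left₀ (by nlinarith [h.left_ge]) h.left_le 2
    have a3 : ((1 - 3 * k) * σ) ^ 2 ≤ (-axisCoord e c q) ^ 2 :=
      pow_le_pow_left₀ (by nlinarith) h.right_ge 2
    have a4 : (-axisCoord e c q) ^ 2 ≤ ((1 + 3 * k) * σ) ^ 2 :=
      pow_le_pow_left₀ (by nlinarith [h.right_ge]) h.right_le 2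
    rw [neg_sq] at a3 a4
    have b1 := sq_nonneg ‖perpPart e c p‖
    have b2 := sq_nonneg ‖perpPart e c q‖
    rw [abs_le]
    constructor <;> linarith
  have h3 : σ * |axisCoord e c w| ≤ σ * (8 * k * (σ + ‖perpPart e c w‖)) := by
    nlinarith [mul_nonneg (mul_pos hk hσ).le (norm_nonneg (perpPart e c w))]
  exact le_of_mul_le_mul_left h3 hσ

theorem NearAxisPair.exists_axis_mem_perpBisector {σ : ℝ} {p q : E}
    (h : NearAxisPair e c k σ p q) (he : ‖e‖ = 1) (hσ : 0 < σ) (hk : 0 < k) (hk' : k ≤ 1 / 20) :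
    ∃ τ : ℝ, c + τ • e ∈ AffineSubspace.perpBisector p q ∧ |τ| ≤ 8 * k * σ := by
  have hd : 0 < axisCoord e c p - axisCoord e c q := by
    have := h.left_ge
    have := h.right_ge
    nlinarith
  -- The witness solves the bisector equation with zero orthogonal part; its size is then a case of
  -- the bound for all bisector points.
  refine (fun ⟨τ, hτ⟩ => ⟨τ, hτ, ?_⟩ : (∃ τ : ℝ, c + τ • e ∈ AffineSubspace.perpBisector p q) → _)
    ⟨(axisCoord e c p ^ 2 + ‖perpPart e c p‖ ^ 2 -
      (axisCoord e c q ^ 2 + ‖perpPart e c q‖ ^ 2)) /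
        (2 * (axisCoord e c p - axisCoord e c q)), ?_⟩
  · have := h.abs_axisCoord_le he hσ hk hk' hτ
    simpa [axisCoord_axis he, perpPart_axis he] using this
  · rw [mem_perpBisector_iff_coord (c := c) he, axisCoord_axis he, perpPart_axis he]
    simp only [inner_zero_left]
    field_simp
    ring

/-- If the bisector passes through the centre, then it is a transversal cone to the axis. -/
theorem NearAxisPair.abs_axisCoord_le_of_center_mem {σ : ℝ} {p q w : E}
    (h : NearAxisPair e c k σ p q) (he : ‖e‖ = 1) (hσ : 0 < σ) (hk' : k ≤ 1 / 20)
    (hc : c ∈ AffineSubspace.perpBisector p q) (hw : w ∈ AffineSubspace.perpBisector p q) :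
    |axisCoord e c w| ≤ 2 * k * ‖perpPart e c w‖ := by
  have h1 := h.mul_abs_axisCoord_le he hσ hk' hw
  rw [mem_perpBisector_iff_coord (c := c) he] at hc
  simp only [axisCoord_self, perpPart_self, inner_zero_left] at hc
  rw [← hc] at h1
  have h2 : σ * |axisCoord e c w| ≤ σ * (2 * k * ‖perpPart e c w‖) := by
    simp at h1
    linarith
  exact le_of_mul_le_mul_left h2 hσ

/-- On the bisector of a pair close to the axis, `f` is bounded below by a convex quadratic. -/
theorem SaddleModel.bisector_lower (h : SaddleModel f c e a b B η k r) {σ : ℝ} (hσ : 0 < σ)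
    {p q w : E} (hpq : NearAxisPair e c k σ p q) (hw : w ∈ AffineSubspace.perpBisector p q)
    (hwr : w ∈ Metric.ball c r) :
    b / 4 * ‖perpPart e c w‖ ^ 2 - 96 * a * k ^ 2 * σ ^ 2 ≤ f w - f c := by
  have h1 := hpq.abs_axisCoord_le h.norm_axis hσ h.k_pos h.k_le hw
  have h2 := h.lower w hwr
  have ha := h.a_pos
  have hη := h.η_pos
  have hη' : 1 + η ≤ 3 / 2 := by linarith [h.η_le, h.k_le]
  set n := ‖perpPart e c w‖
  have h3 : axisCoord e c w ^ 2 ≤ (8 * k * (σ + n)) ^ 2 := by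
    rw [← sq_abs]; gcongr
  have h4 : (8 * k * (σ + n)) ^ 2 ≤ 128 * k ^ 2 * (σ ^ 2 + n ^ 2) := by
    nlinarith [mul_nonneg (sq_nonneg k) (sq_nonneg (σ - n))]
  -- The factor is `3 / 2 * 128 = 192`. After halving, `k_small` lets the `n ^ 2` part consume at
  -- most half of `b / 2`, leaving `b / 4`.
  have h5 : a * (1 + η) * axisCoord e c w ^ 2 ≤
      a * (3 / 2) * (128 * k ^ 2 * (σ ^ 2 + n ^ 2)) := by
    gcongr
    exact h3.trans h4
  have h6 := mul_le_mul_of_nonneg_right h.k_small (sq_nonneg n)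
  linarith

/-- A minimizer on the bisector at the critical level is the critical point. -/
theorem SaddleModel.eq_center_of_center_mem (h : SaddleModel f c e a b B η k r) {σ : ℝ}
    (hσ : 0 < σ) {p q w : E} (hpq : NearAxisPair e c k σ p q)
    (hc : c ∈ AffineSubspace.perpBisector p q) (hw : w ∈ AffineSubspace.perpBisector p q)
    (hwr : w ∈ Metric.ball c r) (hfw : f w ≤ f c) : w = c := by
  have h1 := hpq.abs_axisCoord_le_of_center_mem h.norm_axis hσ h.k_le hc hw
  have h2 := h.lower w hwr
  have ha := h.a_pos
  have hη := h.η_pos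
  have hb := h.b_pos
  have hk := h.k_pos
  have hη' : 1 + η ≤ 3 / 2 := by linarith [h.η_le, h.k_le]
  set n := ‖perpPart e c w‖ with hn
  have h3 : axisCoord e c w ^ 2 ≤ (2 * k * n) ^ 2 := by
    rw [← sq_abs]; gcongr
  have h5 : a * (1 + η) * axisCoord e c w ^ 2 ≤ a * (3 / 2) * (2 * k * n) ^ 2 := by
    gcongr
  have h6 := mul_le_mul_of_nonneg_right h.k_small (sq_nonneg n)
  have h7 : b * n ^ 2 ≤ 0 := by nlinarith [mul_nonneg hb.le (sq_nonneg n)]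
  have h8 : n = 0 := by
    by_contra h0
    have : 0 < b * n ^ 2 := by positivity
    linarith
  rw [h8] at h1
  have h9 : axisCoord e c w = 0 := by simpa using h1
  have := norm_sub_sq_eq_coord (c := c) h.norm_axis w
  rw [h9, ← hn, h8] at this
  simpa [sub_eq_zero] using this

end SaddleModel

/-! ### Connectedness of one side of a sublevel set -/

section Sublevel

variable {E : Type*} [NormedAddCommGroup E] [InnerProductSpace ℝ E]

theorem axisCoord_combo (e c x y : E) {α β : ℝ} (h : α + β = 1) :
    axisCoord e c (α • x + β • y) = α * axisCoord e c x + β * axisCoord e c y := by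
  have : α • x + β • y - c = α • (x - c) + β • (y - c) := by
    rw [smul_sub, smul_sub, sub_add_sub_comm, ← add_smul, h, one_smul]
  simp [axisCoord, this, inner_add_right, inner_smul_right]

theorem perpPart_combo (e c x y : E) {α β : ℝ} (h : α + β = 1) :
    perpPart e c (α • x + β • y) = α • perpPart e c x + β • perpPart e c y := by
  have : α • x + β • y - c = α • (x - c) + β • (y - c) := by
    rw [smul_sub, smul_sub, sub_add_sub_comm, ← add_smul, h, one_smul]
  rw [perpPart, axisCoord_combo e c x y h, this, perpPart, perpPart]
  module

/-- Monotonicity of `f` away from the axis, and along the axis inside the cone of slope `κ`. -/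
structure SaddleSlopes (f : E → ℝ) (c e : E) (a κ r : ℝ) : Prop where
  κ_pos : 0 < κ
  κ_le : κ ≤ 1
  differentiableAt : ∀ x ∈ Metric.ball c r, DifferentiableAt ℝ f x
  perp_slope : ∀ x ∈ Metric.ball c r, κ * |axisCoord e c x| ≤ ‖perpPart e c x‖ →
    0 ≤ fderiv ℝ f x (perpPart e c x)
  axis_slope : ∀ x ∈ Metric.ball c r, ‖perpPart e c x‖ ≤ κ * |axisCoord e c x| →
    fderiv ℝ f x e * axisCoord e c x ≤ 0
  cone_le : ∀ x ∈ Metric.ball c r, ‖perpPart e c x‖ ≤ κ * |axisCoord e c x| →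
    f x - f c ≤ -(a / 4 * axisCoord e c x ^ 2)

variable {f : E → ℝ} {c e : E} {a b B η k κ r θ L : ℝ}

theorem SaddleSlopes.neg (h : SaddleSlopes f c e a κ r) : SaddleSlopes f c (-e) a κ r :=
  { h with
    perp_slope := by simpa using h.perp_slope
    axis_slope := by simpa using h.axis_slope
    cone_le := by simpa using h.cone_le }

/-- The part of a sublevel set in a ball on the positive side of the axis. -/
def positivePart (f : E → ℝ) (c e : E) (θ L : ℝ) : Set E :=
  {p | p ∈ Metric.ball c θ ∧ f p ≤ L ∧ 0 < axisCoord e c p}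

/-- Moving straight towards the axis does not raise `f` as long as the path stays outside the open
cone; this is `perp_slope` integrated along the path. -/
theorem SaddleSlopes.le_of_shrink (h : SaddleSlopes f c e a κ r) (he : ‖e‖ = 1) {x : E}
    (hx : x ∈ Metric.ball c r) (hr : 0 < r) {μ : ℝ} (hμ0 : 0 ≤ μ) (hμ1 : μ ≤ 1)
    (hμ : κ * |axisCoord e c x| ≤ μ * ‖perpPart e c x‖) :
    f (c + axisCoord e c x • e + μ • perpPart e c x) ≤ f x := by
  set t := axisCoord e c x with ht
  set v := perpPart e c x with hv
  have hev : inner ℝ e v = 0 := inner_perpPart he x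
  have hevs : ∀ l : ℝ, inner ℝ e (l • v) = 0 := fun l => by simp [inner_smul_right, hev]
  have hball : ∀ l ∈ Set.Icc μ 1, c + t • e + l • v ∈ Metric.ball c r := by
    intro l hl
    rw [mem_ball_iff_coord he hr, ← ht, ← hv] at hx
    rw [mem_ball_iff_coord he hr, axisCoord_add he t (hevs l), perpPart_add he t (hevs l),
      norm_smul, mul_pow, Real.norm_eq_abs, sq_abs]
    have : l ^ 2 ≤ 1 := by nlinarith [hl.1, hl.2]
    nlinarith [mul_le_mul_of_nonneg_right this (sq_nonneg ‖v‖)]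
  have hderiv : ∀ l ∈ Set.Icc μ 1, HasDerivAt (fun l : ℝ => f (c + t • e + l • v))
      (fderiv ℝ f (c + t • e + l • v) v) l := by
    intro l hl
    have hline : HasDerivAt (fun l : ℝ => c + t • e + l • v) v l := by
      simpa using ((hasDerivAt_id l).smul_const v).const_add (c + t • e)
    exact (h.differentiableAt _ (hball l hl)).hasFDerivAt.comp_hasDerivAt l hline
  have hmono : MonotoneOn (fun l : ℝ => f (c + t • e + l • v)) (Set.Icc μ 1) := by
    refine monotoneOn_of_deriv_nonneg (convex_Icc μ 1)
      (fun l hl => (hderiv l hl).continuousAt.continuousWithinAt)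
      (fun l hl => (hderiv l (interior_subset hl)).differentiableAt.differentiableWithinAt) ?_
    intro l hl
    have hl' := interior_subset hl
    rw [interior_Icc] at hl
    have hl0 : 0 < l := hμ0.trans_lt hl.1
    rw [(hderiv l hl').deriv]
    have := h.perp_slope _ (hball l hl') (by
      rw [axisCoord_add he t (hevs l), perpPart_add he t (hevs l), norm_smul, Real.norm_eq_abs,
        abs_of_pos hl0]
      exact hμ.trans (mul_le_mul_of_nonneg_right hl'.1 (norm_nonneg v)))
    rw [perpPart_add he t (hevs l), map_smul, smul_eq_mul] at this
    exact (mul_nonneg_iff_of_pos_left hl0).1 this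
  have := hmono (Set.left_mem_Icc.2 hμ1) (Set.right_mem_Icc.2 hμ1) hμ1
  simpa [ht, hv, add_axisCoord_add_perpPart] using this

/-- Moving outwards parallel to the axis keeps a point in the cone, where `axis_slope` makes `f`
nonincreasing. As `κ ≤ 1`, the orthogonal part is at most `T`, so the bound on `2 * T ^ 2` keeps the
path in the ball. -/
theorem SaddleSlopes.le_of_raise (h : SaddleSlopes f c e a κ r) (he : ‖e‖ = 1) {x : E}
    (hr : 0 < r) (htx : 0 < axisCoord e c x)
    (hcone : ‖perpPart e c x‖ ≤ κ * axisCoord e c x) {T : ℝ} (hT : axisCoord e c x ≤ T)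
    (hTr : 2 * T ^ 2 < r ^ 2) :
    f (c + T • e + perpPart e c x) ≤ f x := by
  set t := axisCoord e c x with ht
  set v := perpPart e c x with hv
  have hev : inner ℝ e v = 0 := inner_perpPart he x
  have hκ := h.κ_pos
  have hcone' : ∀ l ∈ Set.Icc t T, ‖v‖ ≤ κ * |l| := by
    intro l hl
    rw [abs_of_pos (htx.trans_le hl.1)]
    exact hcone.trans (mul_le_mul_of_nonneg_left hl.1 hκ.le)
  have hball : ∀ l ∈ Set.Icc t T, c + l • e + v ∈ Metric.ball c r := by
    intro l hl
    rw [mem_ball_iff_coord he hr, axisCoord_add he l hev, perpPart_add he l hev]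
    have h1 : l ^ 2 ≤ T ^ 2 := pow_le_pow_left₀ (htx.le.trans hl.1) hl.2 2
    have h2 : ‖v‖ ≤ T := by nlinarith [h.κ_le]
    have h3 : ‖v‖ ^ 2 ≤ T ^ 2 := by gcongr
    linarith
  have hderiv : ∀ l ∈ Set.Icc t T, HasDerivAt (fun l : ℝ => f (c + l • e + v))
      (fderiv ℝ f (c + l • e + v) e) l := by
    intro l hl
    have hline : HasDerivAt (fun l : ℝ => c + l • e + v) e l := by
      simpa using (((hasDerivAt_id l).smul_const e).const_add c).add_const v
    exact (h.differentiableAt _ (hball l hl)).hasFDerivAt.comp_hasDerivAt l hline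
  have hanti : AntitoneOn (fun l : ℝ => f (c + l • e + v)) (Set.Icc t T) := by
    refine antitoneOn_of_deriv_nonpos (convex_Icc t T)
      (fun l hl => (hderiv l hl).continuousAt.continuousWithinAt)
      (fun l hl => (hderiv l (interior_subset hl)).differentiableAt.differentiableWithinAt) ?_
    intro l hl
    have hl' := interior_subset hl
    rw [(hderiv l hl').deriv]
    have := h.axis_slope _ (hball l hl') (by
      rw [axisCoord_add he l hev, perpPart_add he l hev]
      exact hcone' l hl')
    rw [axisCoord_add he l hev] at this
    exact nonpos_of_mul_nonpos_left this (htx.trans_le hl'.1)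
  have := hanti (Set.left_mem_Icc.2 hT) (Set.right_mem_Icc.2 hT) hT
  simpa [ht, hv, add_axisCoord_add_perpPart] using this

/-- Inside the cone around the axis and far from the centre, everything is joined to the axis. -/
theorem SaddleSlopes.joinedIn_of_far (h : SaddleSlopes f c e a κ r) (he : ‖e‖ = 1) (ha : 0 < a)
    (hθ : 0 < θ) (hθr : θ ≤ r) (hL : f c - a * θ ^ 2 / 16 ≤ L) {x : E}
    (hx : x ∈ Metric.ball c θ) (hcone : ‖perpPart e c x‖ ≤ κ * axisCoord e c x)
    (hfar : θ / 2 ≤ axisCoord e c x) :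
    JoinedIn (positivePart f c e θ L) x (c + (θ / 2) • e) := by
  -- Ball, cone and half-space are convex, and in the cone at height at least `θ / 2` the bound
  -- `cone_le` gives `f ≤ f c - a * θ ^ 2 / 16`. This is where that threshold for the level comes
  -- from.
  refine JoinedIn.of_segment_subset ?_
  rintro p ⟨α, β, hα, hβ, hαβ, rfl⟩
  have h0 : c + (θ / 2) • e ∈ Metric.ball c θ := by
    simp only [mem_ball_iff_norm, add_sub_cancel_left, norm_smul, he, Real.norm_eq_abs]
    rw [abs_of_pos (by positivity)]; linarith
  have hball := (convex_ball c θ) hx h0 hα hβ hαβ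
  have hκ := h.κ_pos
  have ht : θ / 2 ≤ axisCoord e c (α • x + β • (c + (θ / 2) • e)) := by
    rw [axisCoord_combo e c _ _ hαβ, axisCoord_axis he]
    have : θ / 2 = α * (θ / 2) + β * (θ / 2) := by rw [← add_mul, hαβ, one_mul]
    nlinarith
  have hpos : 0 < axisCoord e c (α • x + β • (c + (θ / 2) • e)) := by linarith
  have hc : ‖perpPart e c (α • x + β • (c + (θ / 2) • e))‖ ≤
      κ * |axisCoord e c (α • x + β • (c + (θ / 2) • e))| := by
    rw [abs_of_pos hpos, axisCoord_combo e c _ _ hαβ, perpPart_combo e c _ _ hαβ,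
      axisCoord_axis he, perpPart_axis he, smul_zero, add_zero, norm_smul, Real.norm_eq_abs,
      abs_of_nonneg hα]
    nlinarith [mul_le_mul_of_nonneg_left hcone hα, mul_nonneg hκ.le (mul_nonneg hβ hθ.le)]
  refine ⟨hball, ?_, hpos⟩
  have h1 := h.cone_le _ (Metric.ball_subset_ball hθr hball) hc
  have h2 : (θ / 2) ^ 2 ≤ axisCoord e c (α • x + β • (c + (θ / 2) • e)) ^ 2 := by gcongr
  nlinarith

/-- A point of the cone below height `θ / 2` is first raised to that height, where the convex far
region takes over. -/
theorem SaddleSlopes.joinedIn_of_cone (h : SaddleSlopes f c e a κ r) (he : ‖e‖ = 1) (ha : 0 < a)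
    (hθ : 0 < θ) (hθr : θ ≤ r) (hL : f c - a * θ ^ 2 / 16 ≤ L) {x : E}
    (hx : x ∈ positivePart f c e θ L) (hcone : ‖perpPart e c x‖ ≤ κ * axisCoord e c x) :
    JoinedIn (positivePart f c e θ L) x (c + (θ / 2) • e) := by
  obtain ⟨hxb, hfx, htx⟩ := hx
  rcases le_or_gt (θ / 2) (axisCoord e c x) with hfar | hnear
  · exact h.joinedIn_of_far he ha hθ hθr hL hxb hcone hfar
  have hev : inner ℝ e (perpPart e c x) = 0 := inner_perpPart he x
  have hκ := h.κ_pos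
  have hmem : ∀ T, axisCoord e c x ≤ T → T ≤ θ / 2 →
      c + T • e + perpPart e c x ∈ positivePart f c e θ L := by
    intro T hT hTθ
    have hT0 : 0 < T := htx.trans_le hT
    have hT2 : T ^ 2 ≤ (θ / 2) ^ 2 := by gcongr
    refine ⟨?_, (h.le_of_raise he (hθ.trans_le hθr) htx hcone hT ?_).trans hfx, ?_⟩
    · rw [mem_ball_iff_coord he hθ, axisCoord_add he T hev, perpPart_add he T hev]
      have h2 : ‖perpPart e c x‖ ≤ T := by nlinarith [h.κ_le]
      have h3 : ‖perpPart e c x‖ ^ 2 ≤ T ^ 2 := by gcongr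
      nlinarith
    · have : θ ^ 2 ≤ r ^ 2 := by gcongr
      nlinarith
    · rwa [axisCoord_add he T hev]
  refine JoinedIn.trans (y := c + (θ / 2) • e + perpPart e c x) ?_ ?_
  · refine JoinedIn.of_segment_subset ?_
    rintro p ⟨α, β, hα, hβ, hαβ, rfl⟩
    have hp : α • x + β • (c + (θ / 2) • e + perpPart e c x) =
        c + (α * axisCoord e c x + β * (θ / 2)) • e + perpPart e c x := by
      conv_lhs => rw [← add_axisCoord_add_perpPart e c x]
      obtain rfl : α = 1 - β := by linarith
      simp only [perpPart_add he _ hev]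
      module
    rw [hp]
    have e1 : axisCoord e c x = α * axisCoord e c x + β * axisCoord e c x := by
      rw [← add_mul, hαβ, one_mul]
    have e2 : θ / 2 = α * (θ / 2) + β * (θ / 2) := by rw [← add_mul, hαβ, one_mul]
    exact hmem _ (by nlinarith) (by nlinarith)
  · have := hmem (θ / 2) hnear.le le_rfl
    refine h.joinedIn_of_far he ha hθ hθr hL this.1 ?_ ?_
    · rw [axisCoord_add he _ hev, perpPart_add he _ hev]; nlinarith
    · rw [axisCoord_add he _ hev]

/-- Every point on the positive side of a sublevel set is joined to the axis. -/
theorem SaddleSlopes.joinedIn_axis (h : SaddleSlopes f c e a κ r) (he : ‖e‖ = 1) (ha : 0 < a)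
    (hθ : 0 < θ) (hθr : θ ≤ r) (hL : f c - a * θ ^ 2 / 16 ≤ L) {x : E}
    (hx : x ∈ positivePart f c e θ L) :
    JoinedIn (positivePart f c e θ L) x (c + (θ / 2) • e) := by
  rcases le_or_gt ‖perpPart e c x‖ (κ * axisCoord e c x) with hcone | hout
  · exact h.joinedIn_of_cone he ha hθ hθr hL hx hcone
  have hx0 := hx
  obtain ⟨hxb, hfx, htx⟩ := hx
  have hκ := h.κ_pos
  have hev : inner ℝ e (perpPart e c x) = 0 := inner_perpPart he x
  have hevs : ∀ l : ℝ, inner ℝ e (l • perpPart e c x) = 0 := fun l => by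
    simp [inner_smul_right, hev]
  have hn : 0 < ‖perpPart e c x‖ := lt_trans (by positivity) hout
  -- Shrinking the orthogonal part by `μ` brings the point exactly onto the boundary of the cone.
  set μ := κ * axisCoord e c x / ‖perpPart e c x‖ with hμ
  have hμn : μ * ‖perpPart e c x‖ = κ * axisCoord e c x := by
    rw [hμ]; field_simp
  have hμ0 : 0 ≤ μ := by positivity
  have hμ1 : μ ≤ 1 := by rw [hμ, div_le_one hn]; exact hout.le
  have hmem : ∀ l, μ ≤ l → l ≤ 1 →
      c + axisCoord e c x • e + l • perpPart e c x ∈ positivePart f c e θ L := by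
    intro l hl hl1
    refine ⟨?_, (h.le_of_shrink he (Metric.ball_subset_ball hθr hxb) (hθ.trans_le hθr)
      (hμ0.trans hl) hl1 ?_).trans hfx, ?_⟩
    · rw [mem_ball_iff_coord he hθ] at hxb
      rw [mem_ball_iff_coord he hθ, axisCoord_add he _ (hevs l), perpPart_add he _ (hevs l),
        norm_smul, mul_pow, Real.norm_eq_abs, sq_abs]
      have : l ^ 2 ≤ 1 := by nlinarith
      nlinarith [mul_le_mul_of_nonneg_right this (sq_nonneg ‖perpPart e c x‖)]
    · rw [abs_of_pos htx, ← hμn]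
      gcongr
    · rwa [axisCoord_add he _ (hevs l)]
  refine JoinedIn.trans (y := c + axisCoord e c x • e + μ • perpPart e c x) ?_ ?_
  · refine JoinedIn.of_segment_subset ?_
    rintro p ⟨α, β, hα, hβ, hαβ, rfl⟩
    have hp : α • x + β • (c + axisCoord e c x • e + μ • perpPart e c x) =
        c + axisCoord e c x • e + (α + β * μ) • perpPart e c x := by
      conv_lhs => rw [← add_axisCoord_add_perpPart e c x]
      obtain rfl : α = 1 - β := by linarith
      simp only [axisCoord_add he _ hev, perpPart_add he _ hev]
      module
    rw [hp]
    exact hmem _ (by nlinarith) (by nlinarith)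
  · refine h.joinedIn_of_cone he ha hθ hθr hL (hmem μ le_rfl hμ1) ?_
    rw [axisCoord_add he _ (hevs μ), perpPart_add he _ (hevs μ), norm_smul, Real.norm_eq_abs,
      abs_of_nonneg hμ0, hμn]

end Sublevel

/-! ### Path components of the sublevel set -/

section Components

variable {n : ℕ} {f : EuclideanSpace ℝ (Fin n) → ℝ} {c e : EuclideanSpace ℝ (Fin n)}
  {a b B η k κ r θ L : ℝ}

/-- The component of a point on the positive side is the whole positive side. -/
theorem pathComponentIn_eq_positivePart (hM : SaddleModel f c e a b B η k r)
    (hS : SaddleSlopes f c e a κ r) (hθ : 0 < θ) (hθr : θ ≤ r)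
    (hL : f c - a * θ ^ 2 / 16 ≤ L) (hLc : L < f c) {x : EuclideanSpace ℝ (Fin n)}
    (hx : x ∈ positivePart f c e θ L) :
    pathComponentIn (levelSetIn f (Metric.ball c θ) L) x = positivePart f c e θ L := by
  apply Set.Subset.antisymm
  · intro p hp
    have hpL := pathComponentIn_subset hp
    have hxL : x ∈ levelSetIn f (Metric.ball c θ) L := ⟨hx.2.1, hx.1⟩
    refine ⟨hpL.2, hpL.1, ?_⟩
    by_contra! hneg
    -- A component meeting both sides would contain a point of height zero, where `f ≥ f c`.
    obtain ⟨q, hq, hq0⟩ := (isPathConnected_pathComponentIn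
      hxL).isConnected.isPreconnected.intermediate_value hp (mem_pathComponentIn_self hxL)
      (continuous_axisCoord e c).continuousOn ⟨hneg, hx.2.2.le⟩
    have hqL := pathComponentIn_subset hq
    have h1 := hM.lower q (Metric.ball_subset_ball hθr hqL.2)
    have h2 : f q ≤ L := hqL.1
    rw [hq0] at h1
    have := mul_nonneg hM.b_pos.le (sq_nonneg ‖perpPart e c q‖)
    nlinarith
  · intro p hp
    have h1 := hS.joinedIn_axis hM.norm_axis hM.a_pos hθ hθr hL hx
    have h2 := hS.joinedIn_axis hM.norm_axis hM.a_pos hθ hθr hL hp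
    exact (h1.trans h2.symm).mono fun q hq => ⟨hq.2.1, hq.1⟩

end Components

/-! ### Existence of the saddle model -/

section ModelExistence

variable {n : ℕ} {f : EuclideanSpace ℝ (Fin n) → ℝ} {c : EuclideanSpace ℝ (Fin n)}

/-- Near a nondegenerate critical point of index one, `f` is close to a quadratic saddle. -/
theorem exists_saddleModel (hf : ContDiffAt ℝ 2 f c) (hcrit : IsNondegenerateCriticalPoint f c)
    (hindex : HasMorseIndex f c 1) :
    ∃ (e : EuclideanSpace ℝ (Fin n)) (a b B κ r : ℝ), 0 < a ∧ 0 < b ∧ 0 < r ∧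
      SaddleSlopes f c e a κ r ∧ ∀ k, 0 < k → k ≤ 1 / 20 → 384 * a * k ^ 2 ≤ b →
        ∃ η r', SaddleModel f c e a b B η k r' := by
  have hsymm : ∀ u v, hessian f c u v = hessian f c v u := fun u v =>
    (hf.isSymmSndFDerivAt (by simp)) u v
  obtain ⟨e, a, b, he, ha, hb, hHe, hHb⟩ := exists_negative_axis (hessian f c) hsymm
    hcrit.hessian_invertible.1 hindex
  set B := ‖hessian f c‖ + 1 with hB
  have hBpos : 0 < B := by positivity
  have hv : ∀ x, hessian f c (perpPart e c x) e = 0 := by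
    intro x; rw [hHe, inner_perpPart he, mul_zero]
  have hHv : ∀ x, hessian f c (x - c) (perpPart e c x) =
      hessian f c (perpPart e c x) (perpPart e c x) := by
    intro x
    conv_lhs => rw [← axisCoord_smul_add_perpPart e c x]
    simp [hsymm e, hv]
  have hHx : ∀ x, hessian f c (x - c) (x - c) =
      -a * axisCoord e c x ^ 2 + hessian f c (perpPart e c x) (perpPart e c x) := by
    intro x
    conv_lhs => arg 2; rw [← axisCoord_smul_add_perpPart e c x]
    rw [map_add, map_smul, hHv, hHe, smul_eq_mul, axisCoord]
    ring
  have hHB : ∀ x, hessian f c (perpPart e c x) (perpPart e c x) ≤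
      ‖hessian f c‖ * ‖perpPart e c x‖ ^ 2 := by
    intro x
    have := (le_abs_self _).trans ((hessian f c).le_opNorm₂ (perpPart e c x) (perpPart e c x))
    linarith [this]
  have hlow : ∀ x, b * ‖perpPart e c x‖ ^ 2 ≤
      hessian f c (perpPart e c x) (perpPart e c x) := fun x => hHb _ (inner_perpPart he x)
  have hnorm : ∀ x, ‖x - c‖ ≤ |axisCoord e c x| + ‖perpPart e c x‖ := by
    intro x
    conv_lhs => rw [← axisCoord_smul_add_perpPart e c x]
    refine (norm_add_le _ _).trans ?_
    rw [norm_smul, he, mul_one, Real.norm_eq_abs]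
  -- The cone is so narrow that the negative direction dominates the positive part of the Hessian
  -- inside it.
  obtain ⟨κ, hκ, hκ1, hκB⟩ : ∃ κ : ℝ, 0 < κ ∧ κ ≤ 1 ∧ B * κ ^ 2 ≤ a / 4 := by
    refine ⟨min 1 (a / (4 * B)), by positivity, min_le_left _ _, ?_⟩
    have h1 : min 1 (a / (4 * B)) ≤ 1 := min_le_left _ _
    have h2 : min 1 (a / (4 * B)) ≤ a / (4 * B) := min_le_right _ _
    have h0 : 0 < min 1 (a / (4 * B)) := by positivity
    calc B * min 1 (a / (4 * B)) ^ 2 ≤ B * (a / (4 * B)) := by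
          gcongr; nlinarith
      _ = a / 4 := by field_simp
  obtain ⟨δ, hδ, hδ1, hδb, hδa⟩ : ∃ δ : ℝ, 0 < δ ∧ δ ≤ 1 / 2 ∧ δ ≤ b * κ / 2 ∧ δ ≤ a / 8 :=
    ⟨min (1 / 2) (min (b * κ / 2) (a / 8)), by positivity, min_le_left _ _,
      (min_le_right _ _).trans (min_le_left _ _), (min_le_right _ _).trans (min_le_right _ _)⟩
  obtain ⟨r, hr, hT⟩ := exists_taylor_bounds hf hcrit.fderiv_eq_zero hδ
  -- Halving `b` and adding one to the norm in `B` absorb the Taylor error in the orthogonal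
  -- directions. These constants are fixed before `k`; only `η` and the radius `r'` depend on `k`,
  -- which superlinearity needs.
  refine ⟨e, a, b / 2, B, κ, r, ha, by positivity, hr, ⟨hκ, hκ1, fun x hx => (hT x hx).1,
    ?_, ?_, ?_⟩, ?_⟩
  · intro x hx hxκ
    have h1 := (hT x hx).2.1
    have h2 := (abs_le.1 (((fderiv ℝ f x - hessian f c (x - c)).le_opNorm
      (perpPart e c x)).trans (mul_le_mul_of_nonneg_right h1 (norm_nonneg _)))).1
    rw [sub_apply, hHv] at h2
    have h3 := hlow x
    set m := ‖perpPart e c x‖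
    have hm : 0 ≤ m := norm_nonneg _
    have h4 : κ * ‖x - c‖ ≤ 2 * m := by
      have := mul_le_mul_of_nonneg_left (hnorm x) hκ.le
      nlinarith
    have h5 : δ * ‖x - c‖ ≤ b * m := by
      have := mul_le_mul_of_nonneg_right hδb (norm_nonneg (x - c))
      nlinarith
    nlinarith [mul_le_mul_of_nonneg_right h5 hm]
  · intro x hx hxκ
    have h1 := (hT x hx).2.1
    have h2 := ((fderiv ℝ f x - hessian f c (x - c)).le_opNorm e).trans
      (mul_le_mul_of_nonneg_right h1 (norm_nonneg _))
    rw [sub_apply, hHe, he, mul_one, ← axisCoord] at h2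
    set t := axisCoord e c x
    have h4 : ‖x - c‖ ≤ 2 * |t| := by
      have := hnorm x
      nlinarith [abs_nonneg t]
    have h5 : δ * ‖x - c‖ ≤ a * |t| := by
      have := mul_le_mul_of_nonneg_right hδa (norm_nonneg (x - c))
      nlinarith [abs_nonneg t]
    have h6 : |fderiv ℝ f x e - -a * t| * |t| ≤ a * |t| * |t| :=
      mul_le_mul_of_nonneg_right (h2.trans h5) (abs_nonneg t)
    rw [← abs_mul, mul_assoc, abs_mul_abs_self] at h6
    have h7 := (abs_le.1 h6).2
    linarith
  · intro x hx hxκ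
    have h1 := (abs_le.1 (hT x hx).2.2).2
    have h2 := hHx x
    have h3 := hHB x
    rw [norm_sub_sq_eq_coord (c := c) he] at h1
    unfold hessian at h2 h3
    set t := axisCoord e c x
    set m := ‖perpPart e c x‖
    have h4 : m ^ 2 ≤ κ ^ 2 * t ^ 2 := by
      rw [← sq_abs t, ← mul_pow]; gcongr
    have h5 : B * m ^ 2 ≤ a / 4 * t ^ 2 := by
      calc B * m ^ 2 ≤ B * (κ ^ 2 * t ^ 2) := by gcongr
        _ = B * κ ^ 2 * t ^ 2 := by ring
        _ ≤ a / 4 * t ^ 2 := by gcongr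
    have h6 := mul_le_mul_of_nonneg_right hδa (sq_nonneg t)
    have h7 := mul_le_mul_of_nonneg_right hδ1 (sq_nonneg m)
    rw [hB] at h5
    unfold hessian at h5
    linarith
  · intro k hk hk1 hkb
    obtain ⟨η, hη, hηk, hηs⟩ : ∃ η : ℝ, 0 < η ∧ η ≤ k ∧ 20 * a * η ≤ b / 2 * k ^ 2 := by
      refine ⟨min k (b / 2 * k ^ 2 / (20 * a)), by positivity, min_le_left _ _, ?_⟩
      calc 20 * a * min k (b / 2 * k ^ 2 / (20 * a))
          ≤ 20 * a * (b / 2 * k ^ 2 / (20 * a)) := by gcongr; exact min_le_right _ _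
        _ = b / 2 * k ^ 2 := by field_simp
    -- Twice the Taylor error must fit into the slack of `B`, of `b / 2` and of the relative axis
    -- error `η`, respectively.
    obtain ⟨ε, hε, hε1, hεb, hεa⟩ : ∃ ε : ℝ, 0 < ε ∧ ε ≤ 1 / 2 ∧ ε ≤ b / 4 ∧ ε ≤ a * η / 2 :=
      ⟨min (1 / 2) (min (b / 4) (a * η / 2)), by positivity, min_le_left _ _,
        (min_le_right _ _).trans (min_le_left _ _), (min_le_right _ _).trans (min_le_right _ _)⟩
    obtain ⟨r', hr', hT'⟩ := exists_taylor_bounds hf hcrit.fderiv_eq_zero hε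
    refine ⟨η, r', ⟨he, ha, by positivity, hk, hk1, hkb, hη, hηk, hηs, hr', ?_, ?_⟩⟩
    all_goals
      intro x hx
      have h1 := abs_le.1 (hT' x hx).2.2
      have h2 := hHx x
      have h3 := hHB x
      have h4 := hlow x
      rw [norm_sub_sq_eq_coord (c := c) he] at h1
      have h10 : B * ‖perpPart e c x‖ ^ 2 = (‖hessian f c‖ + 1) * ‖perpPart e c x‖ ^ 2 := by
        rw [hB]
      unfold hessian at h2 h3 h4 h10
      have h5 := mul_le_mul_of_nonneg_right hεa (sq_nonneg (axisCoord e c x))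
      have h6 := mul_le_mul_of_nonneg_right hεb (sq_nonneg ‖perpPart e c x‖)
      have h7 := mul_le_mul_of_nonneg_right hε1 (sq_nonneg ‖perpPart e c x‖)
      obtain ⟨h8, h9⟩ := h1
      linarith

end ModelExistence

/-! ### The furthest point on a segment -/

section FurthestPoint

variable {n : ℕ} {f : EuclideanSpace ℝ (Fin n) → ℝ} {x z x' : EuclideanSpace ℝ (Fin n)}

theorem lineMap_mem_segment_lineMap {l m : ℝ} (hm : 0 ≤ m) (hml : m ≤ l) :
    AffineMap.lineMap x z m ∈ segment ℝ x (AffineMap.lineMap x z l) := by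
  rcases hm.eq_or_lt with rfl | hm0
  · simpa using left_mem_segment ℝ x _
  have hl : 0 < l := hm0.trans_le hml
  rw [segment_eq_image_lineMap]
  refine ⟨m / l, ⟨by positivity, (div_le_one hl).2 hml⟩, ?_⟩
  rw [AffineMap.lineMap_lineMap_right, div_mul_cancel₀ _ hl.ne']

theorem exists_eq_lineMap_of_mem_segment {l : ℝ} (hl : 0 ≤ l) {p : EuclideanSpace ℝ (Fin n)}
    (hp : p ∈ segment ℝ x (AffineMap.lineMap x z l)) :
    ∃ m, 0 ≤ m ∧ m ≤ l ∧ AffineMap.lineMap x z m = p := by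
  rw [segment_eq_image_lineMap] at hp
  obtain ⟨m, hm, rfl⟩ := hp
  refine ⟨m * l, mul_nonneg hm.1 hl, mul_le_of_le_one_left hl hm.2, ?_⟩
  rw [AffineMap.lineMap_lineMap_right]

theorem continuousOn_comp_lineMap (hf : ContinuousOn f (segment ℝ x z)) :
    ContinuousOn (fun m : ℝ => f (AffineMap.lineMap x z m)) (Set.Icc 0 1) := by
  refine hf.comp (by fun_prop) fun m hm => ?_
  rw [segment_eq_image_lineMap]
  exact ⟨m, hm, rfl⟩

/-- The supremum of the admissible parameters is itself admissible, by continuity of `f`. -/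
theorem exists_isFurthestPoint (hf : ContinuousOn f (segment ℝ x z)) (hxz : f x ≤ f z) :
    ∃ x', IsFurthestPoint f x z x' := by
  have hg := continuousOn_comp_lineMap hf
  set g : ℝ → ℝ := fun m => f (AffineMap.lineMap x z m) with hgdef
  set S : Set ℝ := {l | l ∈ Set.Icc (0 : ℝ) 1 ∧ ∀ m, 0 ≤ m → m ≤ l → g m ≤ f z} with hS
  have h0 : (0 : ℝ) ∈ S := by
    refine ⟨⟨le_rfl, zero_le_one⟩, fun m hm hm' => ?_⟩
    obtain rfl : m = 0 := le_antisymm hm' hm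
    simpa [hgdef] using hxz
  have hbdd : BddAbove S := ⟨1, fun l hl => hl.1.2⟩
  have hs0 : 0 ≤ sSup S := le_csSup hbdd h0
  have hs1 : sSup S ≤ 1 := csSup_le ⟨0, h0⟩ fun l hl => hl.1.2
  have hlt : ∀ m, 0 ≤ m → m < sSup S → g m ≤ f z := by
    intro m hm hms
    obtain ⟨l, hl, hml⟩ := exists_lt_of_lt_csSup ⟨0, h0⟩ hms
    exact hl.2 m hm hml.le
  have hle : ∀ m, 0 ≤ m → m ≤ sSup S → g m ≤ f z := by
    intro m hm hms
    rcases hms.lt_or_eq with h | rfl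
    · exact hlt m hm h
    rcases hs0.eq_or_lt with h | h
    · rw [← h]; exact h0.2 0 le_rfl le_rfl
    have hcl : sSup S ∈ closure (Set.Ico 0 (sSup S)) := by
      rw [closure_Ico h.ne]; exact Set.right_mem_Icc.2 hs0
    refine ContinuousWithinAt.closure_le hcl ?_ continuousWithinAt_const fun m hm => hlt m hm.1 hm.2
    exact (hg _ ⟨hs0, hs1⟩).mono fun m hm => ⟨hm.1, hm.2.le.trans hs1⟩
  refine ⟨AffineMap.lineMap x z (sSup S), ?_, ?_, ?_⟩
  · rw [segment_eq_image_lineMap]; exact ⟨_, ⟨hs0, hs1⟩, rfl⟩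
  · intro p hp
    obtain ⟨m, hm, hm', rfl⟩ := exists_eq_lineMap_of_mem_segment hs0 hp
    exact hle m hm hm'
  · intro w hw hwf
    rw [segment_eq_image_lineMap] at hw
    obtain ⟨l, hl, rfl⟩ := hw
    have : l ≤ sSup S := le_csSup hbdd
      ⟨hl, fun m hm hml => hwf _ (lineMap_mem_segment_lineMap hm hml)⟩
    rw [dist_left_lineMap, dist_left_lineMap, Real.norm_of_nonneg hl.1, Real.norm_of_nonneg hs0]
    gcongr

/-- If `f x' < f z`, then `x' ≠ z`, and by continuity the admissible segment could be prolonged a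
little. -/
theorem IsFurthestPoint.apply_eq (h : IsFurthestPoint f x z x')
    (hf : ContinuousOn f (segment ℝ x z)) : f x' = f z := by
  refine (h.le x' (right_mem_segment ℝ x x')).antisymm (not_lt.1 fun hlt => ?_)
  have hmem := h.mem_segment
  rw [segment_eq_image_lineMap] at hmem
  obtain ⟨l, hl, rfl⟩ := hmem
  have hl1 : l < 1 := by
    refine lt_of_le_of_ne hl.2 fun h1 => ?_
    simp [h1] at hlt
  have hxz : x ≠ z := by
    rintro rfl
    simp at hlt
  have hev := (continuousOn_comp_lineMap hf l hl).eventually (eventually_lt_nhds hlt)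
  rw [eventually_nhdsWithin_iff, Metric.eventually_nhds_iff] at hev
  obtain ⟨ε, hε, hev⟩ := hev
  have hl' : l < min (l + ε / 2) 1 := lt_min (by linarith) hl1
  have h1 : min (l + ε / 2) 1 ≤ 1 := min_le_right _ _
  have h2 : min (l + ε / 2) 1 ≤ l + ε / 2 := min_le_left _ _
  set l' := min (l + ε / 2) 1
  have hl0 : 0 ≤ l' := hl.1.trans hl'.le
  have hd := h.dist_le (AffineMap.lineMap x z l')
    (by rw [segment_eq_image_lineMap]; exact ⟨l', ⟨hl0, h1⟩, rfl⟩) (by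
      intro p hp
      obtain ⟨m, hm, hm', rfl⟩ := exists_eq_lineMap_of_mem_segment hl0 hp
      rcases le_total m l with hml | hml
      · exact h.le _ (lineMap_mem_segment_lineMap hm hml)
      · refine (hev ?_ ⟨hm, hm'.trans h1⟩).le
        rw [Real.dist_eq, abs_of_nonneg (by linarith)]
        linarith)
  rw [dist_left_lineMap, dist_left_lineMap, Real.norm_of_nonneg hl.1, Real.norm_of_nonneg hl0] at hd
  exact absurd (le_of_mul_le_mul_right hd (dist_pos.2 hxz)) (not_le.2 hl')

/-- If `f ≤ f z` on the whole segment, the furthest point is its end. -/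
theorem IsFurthestPoint.eq_right (h : IsFurthestPoint f x z x')
    (hle : ∀ p ∈ segment ℝ x z, f p ≤ f z) : x' = z := by
  have hd := h.dist_le z (right_mem_segment ℝ x z) hle
  have hmem := h.mem_segment
  rw [segment_eq_image_lineMap] at hmem
  obtain ⟨l, hl, rfl⟩ := hmem
  rw [dist_left_lineMap, Real.norm_of_nonneg hl.1] at hd
  rcases eq_or_ne x z with rfl | hxz
  · simp
  have : 1 ≤ l := by
    have := dist_pos.2 hxz
    by_contra! hl1
    nlinarith
  obtain rfl : l = 1 := le_antisymm hl.2 this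
  simp

end FurthestPoint

/-! ### Existence and location of the closest pair -/

section ClosestPair

variable {E : Type*} [NormedAddCommGroup E] [InnerProductSpace ℝ E]
  {f : E → ℝ} {c e : E} {a b B η k r θ L σ : ℝ}

theorem mem_positivePart_neg {p : E} :
    p ∈ positivePart f c (-e) θ L ↔ p ∈ Metric.ball c θ ∧ f p ≤ L ∧ axisCoord e c p < 0 := by
  simp [positivePart]

theorem NearAxisPair.left_mem_closedBall {p q : E} (h : NearAxisPair e c k σ p q) (he : ‖e‖ = 1)
    (hσ : 0 < σ) (hk : 0 < k) (hk' : k ≤ 1 / 20) : p ∈ Metric.closedBall c (2 * σ) := by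
  rw [mem_closedBall_iff_coord he (by positivity)]
  have h1 := h.left_ge
  have h2 : axisCoord e c p ≤ 3 / 2 * σ := h.left_le.trans (by nlinarith)
  have h3 : ‖perpPart e c p‖ ≤ 1 / 20 * σ := h.left_perp.trans (by nlinarith)
  have h4 : axisCoord e c p ^ 2 ≤ (3 / 2 * σ) ^ 2 :=
    pow_le_pow_left₀ (le_trans (by nlinarith) h1) h2 2
  have h5 : ‖perpPart e c p‖ ^ 2 ≤ (1 / 20 * σ) ^ 2 := by gcongr
  nlinarith

theorem NearAxisPair.swap {p q : E} (h : NearAxisPair e c k σ p q) :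
    NearAxisPair (-e) c k σ q p :=
  ⟨by simpa using h.right_ge, by simpa using h.right_le, by simpa using h.left_ge,
    by simpa using h.left_le, by simpa using h.right_perp, by simpa using h.left_perp⟩

theorem NearAxisPair.le_norm_left {p q : E} (h : NearAxisPair e c k σ p q) (he : ‖e‖ = 1)
    (hσ : 0 < σ) (hk' : k ≤ 1 / 20) : σ / 2 ≤ ‖p - c‖ := by
  have h1 := h.left_ge
  have h2 : σ / 2 ≤ axisCoord e c p := le_trans (by nlinarith) h1
  have h3 : axisCoord e c p ≤ ‖p - c‖ := by
    simpa [he, axisCoord] using real_inner_le_norm e (p - c)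
  exact h2.trans h3

theorem SaddleModel.axis_mem_positivePart (h : SaddleModel f c e a b B η k r) (hσ : 0 < σ)
    (hr : 2 * σ < r) (hθ : 2 * σ < θ) :
    c + (σ * (1 + η)) • e ∈ positivePart f c e θ (f c - a * σ ^ 2 / 2) := by
  have hη := h.η_pos
  have hη1 : η ≤ 1 / 20 := h.η_le.trans h.k_le
  have hpos : 0 < σ * (1 + η) := by positivity
  refine ⟨?_, h.axis_le_level hσ (abs_of_pos hpos) hr, ?_⟩
  · simp only [mem_ball_iff_norm, add_sub_cancel_left, norm_smul, h.norm_axis, Real.norm_eq_abs]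
    rw [abs_of_pos hpos]; nlinarith
  · rwa [axisCoord_axis h.norm_axis]

theorem SaddleModel.axis_dist (h : SaddleModel f c e a b B η k r) (hσ : 0 < σ) :
    dist (c + (σ * (1 + η)) • e) (c + (σ * (1 + η)) • -e) = 2 * σ * (1 + η) := by
  have hη := h.η_pos
  have : c + (σ * (1 + η)) • e - (c + (σ * (1 + η)) • -e) = (2 * σ * (1 + η)) • e := by module
  rw [dist_eq_norm, this, norm_smul, h.norm_axis, Real.norm_of_nonneg (by positivity), mul_one]

theorem SaddleModel.nearAxisPair_of_dist_le (h : SaddleModel f c e a b B η k r) (hσ : 0 < σ)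
    (hr : 2 * σ < r) (hθ : 2 * σ < θ) {p q : E} (hpr : p ∈ Metric.ball c r)
    (hqr : q ∈ Metric.ball c r) (hp : p ∈ positivePart f c e θ (f c - a * σ ^ 2 / 2))
    (hq : q ∈ positivePart f c (-e) θ (f c - a * σ ^ 2 / 2))
    (hmin : ∀ p' ∈ positivePart f c e θ (f c - a * σ ^ 2 / 2),
      ∀ q' ∈ positivePart f c (-e) θ (f c - a * σ ^ 2 / 2), dist p q ≤ dist p' q') :
    NearAxisPair e c k σ p q := by
  rw [mem_positivePart_neg] at hq
  refine h.nearAxisPair hσ hpr hqr hp.2.2 hq.2.2 hp.2.1 hq.2.1 ?_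
  rw [← h.axis_dist hσ]
  exact hmin _ (h.axis_mem_positivePart hσ hr hθ) _ (h.neg.axis_mem_positivePart hσ hr hθ)

theorem SaddleModel.axisCoord_ne_zero (h : SaddleModel f c e a b B η k r) {x : E}
    (hx : x ∈ Metric.ball c r) (hfx : f x < f c) : axisCoord e c x ≠ 0 := by
  intro h0
  have h1 := h.lower x hx
  rw [h0] at h1
  have := mul_nonneg h.b_pos.le (sq_nonneg ‖perpPart e c x‖)
  linarith

/-- Below level `f c` the height never vanishes, so the strict condition defining the positive side
may be replaced by the closed condition that the height is nonnegative. -/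
theorem isCompact_positivePart_inter [ProperSpace E] (h : SaddleModel f c e a b B η k r)
    (hf : ContinuousOn f (Metric.ball c θ)) (hθr : θ ≤ r) {R : ℝ} (hR : R < θ) (hL : L < f c) :
    IsCompact (positivePart f c e θ L ∩ Metric.closedBall c R) := by
  have heq : positivePart f c e θ L ∩ Metric.closedBall c R =
      {p ∈ Metric.closedBall c R | f p ≤ L} ∩ {p | 0 ≤ axisCoord e c p} := by
    ext p
    constructor
    · rintro ⟨⟨h1, h2, h3⟩, h4⟩
      exact ⟨⟨h4, h2⟩, h3.le⟩
    · rintro ⟨⟨h1, h2⟩, h3⟩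
      have hb := Metric.closedBall_subset_ball hR h1
      exact ⟨⟨hb, h2, lt_of_le_of_ne h3 (h.axisCoord_ne_zero (Metric.ball_subset_ball hθr hb)
        (h2.trans_lt hL)).symm⟩, h1⟩
  rw [heq]
  have hc : ContinuousOn f (Metric.closedBall c R) := hf.mono (Metric.closedBall_subset_ball hR)
  refine IsCompact.inter_right ?_ (isClosed_le continuous_const (continuous_axisCoord e c))
  exact (isCompact_closedBall c R).of_isClosed_subset
    (hc.preimage_isClosed_of_isClosed Metric.isClosed_closedBall isClosed_Iic)
    fun p hp => hp.1

/-- The sides are not compact, since the ball is open. But any pair at least as close as the two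
reference axis points lies in the closed ball of radius `2 * σ`, so minimizing there suffices. -/
theorem SaddleModel.exists_closest [ProperSpace E] (h : SaddleModel f c e a b B η k r)
    (hf : ContinuousOn f (Metric.ball c θ)) (hθr : θ ≤ r) (hσ : 0 < σ) (hθ : 2 * σ < θ) :
    ∃ p ∈ positivePart f c e θ (f c - a * σ ^ 2 / 2),
      ∃ q ∈ positivePart f c (-e) θ (f c - a * σ ^ 2 / 2),
      ∀ p' ∈ positivePart f c e θ (f c - a * σ ^ 2 / 2),
        ∀ q' ∈ positivePart f c (-e) θ (f c - a * σ ^ 2 / 2), dist p q ≤ dist p' q' := by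
  have ha := h.a_pos
  have hη := h.η_pos
  have hη1 : η ≤ 1 / 20 := h.η_le.trans h.k_le
  have hL : f c - a * σ ^ 2 / 2 < f c := by
    have : 0 < a * σ ^ 2 / 2 := by positivity
    linarith
  have hr : 2 * σ < r := hθ.trans_le hθr
  have hpos : 0 < σ * (1 + η) := by positivity
  have haxis : ∀ u : E, ‖u‖ = 1 → c + (σ * (1 + η)) • u ∈ Metric.closedBall c (2 * σ) := by
    intro u hu
    simp only [mem_closedBall_iff_norm, add_sub_cancel_left, norm_smul, hu, Real.norm_eq_abs]
    rw [abs_of_pos hpos]; nlinarith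
  have hP := h.axis_mem_positivePart hσ hr hθ
  have hQ := h.neg.axis_mem_positivePart hσ hr hθ
  obtain ⟨⟨p, q⟩, ⟨hp, hq⟩, hmin⟩ := ((isCompact_positivePart_inter h hf hθr hθ hL).prod
    (isCompact_positivePart_inter h.neg hf hθr hθ hL)).exists_isMinOn
    ⟨(_, _), ⟨hP, haxis e h.norm_axis⟩, ⟨hQ, haxis (-e) h.neg.norm_axis⟩⟩
    (continuous_dist (α := E)).continuousOn
  have hmin' := isMinOn_iff.1 hmin
  refine ⟨p, hp.1, q, hq.1, fun p' hp' q' hq' => ?_⟩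
  have hpq : dist p q ≤ 2 * σ * (1 + η) := by
    rw [← h.axis_dist hσ]
    exact hmin' (_, _) ⟨⟨hP, haxis e h.norm_axis⟩, ⟨hQ, haxis (-e) h.neg.norm_axis⟩⟩
  rcases le_or_gt (dist p' q') (2 * σ * (1 + η)) with hd | hd
  · have hq'' := mem_positivePart_neg.1 hq'
    have hn := h.nearAxisPair hσ (Metric.ball_subset_ball hθr hp'.1)
      (Metric.ball_subset_ball hθr hq'.1) hp'.2.2 hq''.2.2 hp'.2.1 hq''.2.1 hd
    exact hmin' (p', q') ⟨⟨hp', hn.left_mem_closedBall h.norm_axis hσ h.k_pos h.k_le⟩,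
      ⟨hq', hn.swap.left_mem_closedBall h.neg.norm_axis hσ h.k_pos h.k_le⟩⟩
  · exact hpq.trans hd.le

/-- A point of the positive part closest to a given outside point lies on the level set. -/
theorem apply_eq_of_closest (hf : ContinuousOn f (Metric.ball c θ)) {p q : E}
    (hp : p ∈ positivePart f c e θ L) (hpq : p ≠ q)
    (hmin : ∀ p' ∈ positivePart f c e θ L, dist p q ≤ dist p' q) : f p = L := by
  refine hp.2.1.antisymm (not_lt.1 fun hlt => ?_)
  have hnhds : ∀ᶠ p' in 𝓝 p, p' ∈ positivePart f c e θ L := by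
    filter_upwards [Metric.isOpen_ball.mem_nhds hp.1,
      (hf.continuousAt (Metric.isOpen_ball.mem_nhds hp.1)).eventually (eventually_lt_nhds hlt),
      (continuous_axisCoord e c).continuousAt.eventually (eventually_gt_nhds hp.2.2)]
      with p' h1 h2 h3
    exact ⟨h1, h2.le, h3⟩
  -- If `f p < L`, a neighbourhood of `p` lies in the positive part, and a small move towards `q`
  -- shortens the distance.
  have hline : Tendsto (fun s : ℝ => AffineMap.lineMap p q s) (𝓝[>] 0) (𝓝 p) := by
    have : ContinuousAt (fun s : ℝ => AffineMap.lineMap p q s) 0 := by fun_prop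
    have := this.tendsto
    simp only [AffineMap.lineMap_apply_zero] at this
    exact this.mono_left nhdsWithin_le_nhds
  obtain ⟨s, hs, hs0, hs1⟩ := ((hline.eventually hnhds).and
    (Ioo_mem_nhdsGT (zero_lt_one (α := ℝ)))).exists
  have h1 := hmin _ hs
  rw [dist_lineMap_right, Real.norm_of_nonneg (by linarith)] at h1
  nlinarith [dist_pos.2 hpq]

end ClosestPair

/-! ### Minimizing on the bisector -/

section Bisector

variable {n : ℕ} {f : EuclideanSpace ℝ (Fin n) → ℝ} {c e p q z : EuclideanSpace ℝ (Fin n)}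
  {a b B η k κ r θ σ : ℝ}

theorem SaddleModel.mono (h : SaddleModel f c e a b B η k r) (hθ : 0 < θ) (hθr : θ ≤ r) :
    SaddleModel f c e a b B η k θ :=
  { h with
    r_pos := hθ
    lower := fun x hx => h.lower x (Metric.ball_subset_ball hθr hx)
    upper := fun x hx => h.upper x (Metric.ball_subset_ball hθr hx) }

theorem SaddleSlopes.mono (h : SaddleSlopes f c e a κ r) (hθr : θ ≤ r) :
    SaddleSlopes f c e a κ θ :=
  { h with
    differentiableAt := fun x hx => h.differentiableAt x (Metric.ball_subset_ball hθr hx)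
    perp_slope := fun x hx => h.perp_slope x (Metric.ball_subset_ball hθr hx)
    axis_slope := fun x hx => h.axis_slope x (Metric.ball_subset_ball hθr hx)
    cone_le := fun x hx => h.cone_le x (Metric.ball_subset_ball hθr hx) }

theorem SaddleSlopes.continuousOn (h : SaddleSlopes f c e a κ r) :
    ContinuousOn f (Metric.ball c r) :=
  fun x hx => (h.differentiableAt x hx).continuousAt.continuousWithinAt

/-- The convex lower bound on the bisector confines its points with `f ≤ f c`. This gives the
compactness for the minimizer and places it in any smaller ball that contains radius `2 * σ`. -/
theorem SaddleModel.mem_closedBall_of_mem_perpBisector (h : SaddleModel f c e a b B η k r)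
    (hσ : 0 < σ) (hpq : NearAxisPair e c k σ p q) (hz : z ∈ AffineSubspace.perpBisector p q)
    (hzr : z ∈ Metric.ball c r) (hfz : f z ≤ f c) : z ∈ Metric.closedBall c (2 * σ) := by
  have h1 := h.bisector_lower hσ hpq hz hzr
  have h2 := mul_le_mul_of_nonneg_right h.k_small (sq_nonneg σ)
  have hb := h.b_pos
  have h3 : b * ‖perpPart e c z‖ ^ 2 ≤ b * σ ^ 2 := by linarith
  have h4 : ‖perpPart e c z‖ ≤ σ :=
    (sq_le_sq₀ (norm_nonneg _) hσ.le).1 (le_of_mul_le_mul_left h3 hb)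
  have h5 := hpq.abs_axisCoord_le h.norm_axis hσ h.k_pos h.k_le hz
  have h6 : |axisCoord e c z| ≤ σ := by nlinarith [h.k_le, h.k_pos, norm_nonneg (perpPart e c z)]
  have h7 : axisCoord e c z ^ 2 ≤ σ ^ 2 := by rw [← sq_abs]; gcongr
  have h8 : ‖perpPart e c z‖ ^ 2 ≤ σ ^ 2 := by gcongr
  rw [mem_closedBall_iff_coord h.norm_axis (by positivity)]
  nlinarith

/-- The bisector meets the axis near the centre, in a point where `f ≤ f c`. -/
theorem SaddleModel.exists_axis_mem_perpBisector (h : SaddleModel f c e a b B η k r)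
    (hσ : 0 < σ) (hr : 2 * σ < r) (hpq : NearAxisPair e c k σ p q) :
    ∃ τ : ℝ, c + τ • e ∈ AffineSubspace.perpBisector p q ∧
      c + τ • e ∈ Metric.closedBall c (2 * σ) ∧ f (c + τ • e) ≤ f c - a * τ ^ 2 / 4 := by
  obtain ⟨τ, hτ, hτσ⟩ := hpq.exists_axis_mem_perpBisector h.norm_axis hσ h.k_pos h.k_le
  have hk := h.k_le
  have hτ2 : |τ| ≤ 2 * σ := hτσ.trans (by nlinarith)
  refine ⟨τ, hτ, by simpa [norm_smul, h.norm_axis] using hτ2, ?_⟩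
  have h1 := h.axis_le (hτ2.trans_lt hr)
  have h2 : 1 / 2 ≤ 1 - η := by linarith [h.η_le]
  have h3 : a * (1 / 2) * τ ^ 2 ≤ a * (1 - η) * τ ^ 2 := by
    have := h.a_pos
    gcongr
  linarith

theorem SaddleModel.exists_isBisectorMinimizer (h : SaddleModel f c e a b B η k r)
    (hf : ContinuousOn f (Metric.ball c r)) (hσ : 0 < σ) (hr : 2 * σ < r)
    (hpq : NearAxisPair e c k σ p q) : ∃ z, IsBisectorMinimizer f (Metric.ball c r) p q z := by
  obtain ⟨τ, hτ, hτb, hfτ⟩ := h.exists_axis_mem_perpBisector hσ hr hpq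
  have hcomp : IsCompact
      (Metric.closedBall c (2 * σ) ∩ (AffineSubspace.perpBisector p q : Set _)) :=
    (isCompact_closedBall _ _).inter_right (AffineSubspace.closed_of_finiteDimensional _)
  obtain ⟨z, hz, hmin⟩ := hcomp.exists_isMinOn ⟨_, hτb, hτ⟩
    (hf.mono (Set.inter_subset_left.trans (Metric.closedBall_subset_ball hr)))
  have hmin' := isMinOn_iff.1 hmin
  have hzc : f z ≤ f c := by
    have := hmin' _ ⟨hτb, hτ⟩
    have : 0 ≤ a * τ ^ 2 / 4 := by have := h.a_pos; positivity
    linarith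
  refine ⟨z, hz.2, Metric.closedBall_subset_ball hr hz.1, fun w hw hwr => ?_⟩
  rcases le_or_gt (f w) (f c) with hwc | hwc
  · exact hmin' w ⟨h.mem_closedBall_of_mem_perpBisector hσ hpq hw hwr hwc, hw⟩
  · exact hzc.trans hwc.le

theorem IsBisectorMinimizer.apply_le_center (hz : IsBisectorMinimizer f (Metric.ball c θ) p q z)
    (h : SaddleModel f c e a b B η k r) (hσ : 0 < σ) (hr : 2 * σ < r) (hθ : 2 * σ < θ)
    (hpq : NearAxisPair e c k σ p q) : f z ≤ f c := by
  obtain ⟨τ, hτ, hτb, hfτ⟩ := h.exists_axis_mem_perpBisector hσ hr hpq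
  have := hz.le _ hτ (Metric.closedBall_subset_ball hθ hτb)
  have : 0 ≤ a * τ ^ 2 / 4 := by have := h.a_pos; positivity
  linarith

/-- The bisector meets the axis at a point `c + τ • e` with `f ≤ f c - a * τ ^ 2 / 4`. Minimality at
level `f c` forces `τ = 0`, so `c` lies on the bisector and is the only point there with `f ≤ f c`.
-/
theorem IsBisectorMinimizer.eq_center (hz : IsBisectorMinimizer f (Metric.ball c r) p q z)
    (h : SaddleModel f c e a b B η k r) (hσ : 0 < σ) (hr : 2 * σ < r)
    (hpq : NearAxisPair e c k σ p q) (hfz : f z = f c) : z = c := by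
  obtain ⟨τ, hτ, hτb, hfτ⟩ := h.exists_axis_mem_perpBisector hσ hr hpq
  have h1 := hz.le _ hτ (Metric.closedBall_subset_ball hr hτb)
  have h2 : τ = 0 := by
    by_contra h0
    have : 0 < a * τ ^ 2 / 4 := by have := h.a_pos; positivity
    linarith
  subst h2
  rw [zero_smul, add_zero] at hτ
  exact h.eq_center_of_center_mem hσ hpq hτ hz.mem_bisector hz.mem hfz.le

end Bisector

/-! ### One pass of the algorithm -/

section Step

variable {n : ℕ} {f : EuclideanSpace ℝ (Fin n) → ℝ}
  {c e x y xt yt z x' y' : EuclideanSpace ℝ (Fin n)} {a b B η k κ θ σ : ℝ}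

/-- A pair at a common level slightly below `f c`, on the two sides of the saddle. -/
structure SaddlePair (f : EuclideanSpace ℝ (Fin n) → ℝ) (c e : EuclideanSpace ℝ (Fin n))
    (a θ : ℝ) (x y : EuclideanSpace ℝ (Fin n)) : Prop where
  lt_center : f x < f c
  gt_center_sub : f c - a * θ ^ 2 / 16 < f x
  apply_eq : f x = f y
  left_mem : x ∈ positivePart f c e θ (f x)
  right_mem : y ∈ positivePart f c (-e) θ (f x)

theorem SaddlePair.ne (h : SaddlePair f c e a θ x y) : x ≠ y := by
  rintro rfl
  have h1 := h.left_mem.2.2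
  have h2 := (mem_positivePart_neg.1 h.right_mem).2.2
  linarith

/-- The scale `σ` is the height at which the pure quadratic `-a t² / 2` along the axis attains the
level of the pair. -/
theorem SaddlePair.exists_scale (h : SaddlePair f c e a θ x y) (ha : 0 < a) (hθ : 0 < θ) :
    ∃ σ, 0 < σ ∧ 2 * σ < θ ∧ f x = f c - a * σ ^ 2 / 2 := by
  have h1 := h.lt_center
  have h2 := h.gt_center_sub
  have hpos : 0 < 2 * (f c - f x) / a := by
    have : 0 < f c - f x := by linarith
    positivity
  have hsq : a * √(2 * (f c - f x) / a) ^ 2 = 2 * (f c - f x) := by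
    rw [Real.sq_sqrt hpos.le]; field_simp
  refine ⟨√(2 * (f c - f x) / a), Real.sqrt_pos.2 hpos, ?_, by linarith⟩
  set σ := √(2 * (f c - f x) / a)
  refine lt_of_pow_lt_pow_left₀ 2 hθ.le ?_
  have h3 : a * (2 * σ) ^ 2 < a * θ ^ 2 := by
    have : 0 < a * θ ^ 2 := by positivity
    nlinarith
  exact lt_of_mul_lt_mul_left h3 ha.le

theorem SaddlePair.isClosestPair_iff (h : SaddlePair f c e a θ x y)
    (hM : SaddleModel f c e a b B η k θ) (hS : SaddleSlopes f c e a κ θ) :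
    IsClosestPair f (Metric.ball c θ) x y xt yt ↔
      xt ∈ positivePart f c e θ (f x) ∧ yt ∈ positivePart f c (-e) θ (f x) ∧
        ∀ p ∈ positivePart f c e θ (f x), ∀ q ∈ positivePart f c (-e) θ (f x),
          dist xt yt ≤ dist p q := by
  have h1 := pathComponentIn_eq_positivePart hM hS hM.r_pos le_rfl h.gt_center_sub.le h.lt_center
    h.left_mem
  have h2 := pathComponentIn_eq_positivePart hM.neg hS.neg hM.r_pos le_rfl h.gt_center_sub.le
    h.lt_center h.right_mem
  constructor
  · rintro ⟨h3, h4, h5⟩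
    rw [h1] at h3 h5
    rw [h2] at h4 h5
    exact ⟨h3, h4, h5⟩
  · rintro ⟨h3, h4, h5⟩
    rw [← h1] at h3 h5
    rw [← h2] at h4 h5
    exact ⟨h3, h4, h5⟩

theorem SaddlePair.nearAxisPair (h : SaddlePair f c e a θ x y)
    (hM : SaddleModel f c e a b B η k θ) (hS : SaddleSlopes f c e a κ θ)
    (hσ : 0 < σ) (hσθ : 2 * σ < θ) (hfx : f x = f c - a * σ ^ 2 / 2)
    (hcl : IsClosestPair f (Metric.ball c θ) x y xt yt) : NearAxisPair e c k σ xt yt := by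
  obtain ⟨h1, h2, h3⟩ := (h.isClosestPair_iff hM hS).1 hcl
  rw [hfx] at h1 h2 h3
  exact hM.nearAxisPair_of_dist_le hσ hσθ hσθ h1.1 h2.1 h1 h2 h3

theorem SaddlePair.apply_closest (h : SaddlePair f c e a θ x y)
    (hM : SaddleModel f c e a b B η k θ) (hS : SaddleSlopes f c e a κ θ)
    (hcl : IsClosestPair f (Metric.ball c θ) x y xt yt) : f xt = f x ∧ f yt = f x := by
  obtain ⟨h1, h2, h3⟩ := (h.isClosestPair_iff hM hS).1 hcl
  have hne : xt ≠ yt := by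
    rintro rfl
    have h4 := h1.2.2
    have h5 := (mem_positivePart_neg.1 h2).2.2
    linarith
  refine ⟨apply_eq_of_closest hS.continuousOn h1 hne fun p hp => h3 p hp yt h2,
    apply_eq_of_closest hS.continuousOn h2 hne.symm fun q hq => ?_⟩
  rw [dist_comm yt, dist_comm q]
  exact h3 xt h1 q hq

/-- The gap `f c - f z` after a pass is small relative to the gap `f c - f x` before. -/
theorem SaddlePair.gap_le (h : SaddlePair f c e a θ x y)
    (hM : SaddleModel f c e a b B η k θ) (hS : SaddleSlopes f c e a κ θ)
    (hcl : IsClosestPair f (Metric.ball c θ) x y xt yt)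
    (hz : IsBisectorMinimizer f (Metric.ball c θ) xt yt z) {B' η' k' r' : ℝ}
    (hM' : SaddleModel f c e a b B' η' k' r') (hr' : 8 * (f c - f x) < a * r' ^ 2) :
    f c - f z ≤ 192 * k' ^ 2 * (f c - f x) := by
  obtain ⟨σ, hσ, hσθ, hfx⟩ := h.exists_scale hM.a_pos hM.r_pos
  have hσr : 2 * σ < r' := by
    refine lt_of_pow_lt_pow_left₀ 2 hM'.r_pos.le (lt_of_mul_lt_mul_left ?_ hM.a_pos.le)
    nlinarith
  -- The coarse model on the whole ball first places all points within `2 * σ` of `c`; only then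
  -- does the finer model, valid on the ball of radius `r'`, apply to them.
  have hn := h.nearAxisPair hM hS hσ hσθ hfx hcl
  obtain ⟨h1, h2, h3⟩ := (h.isClosestPair_iff hM hS).1 hcl
  rw [hfx] at h1 h2 h3
  have hn' : NearAxisPair e c k' σ xt yt :=
    hM'.nearAxisPair_of_dist_le hσ hσr hσθ
      (Metric.closedBall_subset_ball hσr
        (hn.left_mem_closedBall hM.norm_axis hσ hM.k_pos hM.k_le))
      (Metric.closedBall_subset_ball hσr
        (hn.swap.left_mem_closedBall hM.neg.norm_axis hσ hM.k_pos hM.k_le)) h1 h2 h3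
  have hzc := hz.apply_le_center hM hσ hσθ hσθ hn
  have hzb := hM.mem_closedBall_of_mem_perpBisector hσ hn hz.mem_bisector hz.mem hzc
  have := hM'.bisector_lower hσ hn' hz.mem_bisector (Metric.closedBall_subset_ball hσr hzb)
  have h4 := mul_nonneg hM.b_pos.le (sq_nonneg ‖perpPart e c z‖)
  rw [hfx]
  linarith

theorem SaddlePair.gap_le_half (h : SaddlePair f c e a θ x y)
    (hM : SaddleModel f c e a b B η k θ) (hS : SaddleSlopes f c e a κ θ)
    (hcl : IsClosestPair f (Metric.ball c θ) x y xt yt)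
    (hz : IsBisectorMinimizer f (Metric.ball c θ) xt yt z) :
    f c - f z ≤ (f c - f x) / 2 := by
  have h1 := h.gap_le hM hS hcl hz hM (by
    have := h.gt_center_sub
    have : 0 < a * θ ^ 2 := by have := hM.a_pos; have := hM.r_pos; positivity
    linarith)
  -- The bound `k ≤ 1 / 20` is enough because `192 / 400 < 1 / 2`.
  have h2 : k ^ 2 ≤ (1 / 20) ^ 2 := pow_le_pow_left₀ hM.k_pos.le hM.k_le 2
  nlinarith [h.lt_center]

theorem SaddlePair.segment_subset_ball (h : SaddlePair f c e a θ x y)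
    (hM : SaddleModel f c e a b B η k θ) (hS : SaddleSlopes f c e a κ θ)
    (hcl : IsClosestPair f (Metric.ball c θ) x y xt yt)
    (hz : IsBisectorMinimizer f (Metric.ball c θ) xt yt z) :
    segment ℝ xt z ⊆ Metric.ball c θ ∧ segment ℝ yt z ⊆ Metric.ball c θ := by
  obtain ⟨h1, h2, -⟩ := (h.isClosestPair_iff hM hS).1 hcl
  exact ⟨(convex_ball c θ).segment_subset h1.1 hz.mem,
    (convex_ball c θ).segment_subset h2.1 hz.mem⟩

/-- From a pair around the saddle, a pass of the algorithm can be carried out. -/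
theorem SaddlePair.exists_step (h : SaddlePair f c e a θ x y)
    (hM : SaddleModel f c e a b B η k θ) (hS : SaddleSlopes f c e a κ θ) :
    ∃ xt yt z x' y', IsLevelSetStep f (Metric.ball c θ) x y xt yt z x' y' := by
  obtain ⟨σ, hσ, hσθ, hfx⟩ := h.exists_scale hM.a_pos hM.r_pos
  obtain ⟨xt, hxt, yt, hyt, hmin⟩ := hM.exists_closest hS.continuousOn le_rfl hσ hσθ
  rw [← hfx] at hxt hyt hmin
  have hcl := (h.isClosestPair_iff hM hS).2 ⟨hxt, hyt, hmin⟩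
  have hn := h.nearAxisPair hM hS hσ hσθ hfx hcl
  obtain ⟨z, hz⟩ := hM.exists_isBisectorMinimizer hS.continuousOn hσ hσθ hn
  obtain ⟨hsx, hsy⟩ := h.segment_subset_ball hM hS hcl hz
  have hgap := h.gap_le_half hM hS hcl hz
  obtain ⟨hfxt, hfyt⟩ := h.apply_closest hM hS hcl
  have hlt := h.lt_center
  obtain ⟨x', hx'⟩ := exists_isFurthestPoint (hS.continuousOn.mono hsx) (by linarith)
  obtain ⟨y', hy'⟩ := exists_isFurthestPoint (hS.continuousOn.mono hsy) (by linarith)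
  exact ⟨xt, yt, z, x', y', hcl, hz, hx', hy'⟩

/-- On the way from `xt` to `x'` the values stay at most `f z < f c`, so the height cannot pass
through zero. -/
theorem mem_positivePart_of_isFurthestPoint (hM : SaddleModel f c e a b B η k θ)
    (hseg : segment ℝ xt z ⊆ Metric.ball c θ) (hpos : 0 < axisCoord e c xt) (hfz : f z < f c)
    (hx' : IsFurthestPoint f xt z x') : x' ∈ positivePart f c e θ (f z) := by
  refine ⟨hseg hx'.mem_segment, hx'.le x' (right_mem_segment ℝ xt x'), ?_⟩
  by_contra! hneg
  obtain ⟨q, hq, hq0⟩ := (convex_segment xt x').isPreconnected.intermediate_value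
    (right_mem_segment ℝ xt x') (left_mem_segment ℝ xt x')
    (continuous_axisCoord e c).continuousOn ⟨hneg, hpos.le⟩
  exact hM.axisCoord_ne_zero (hseg ((convex_segment xt z).segment_subset
    (left_mem_segment ℝ xt z) hx'.mem_segment hq)) ((hx'.le q hq).trans_lt hfz) hq0

/-- Since `2 * k ≤ κ`, the point `xt` lies in the cone of slope `κ`; the segment to the apex `c`
stays in it, and there `f ≤ f c`. Hence the furthest point for `z = c` is `c` itself. -/
theorem NearAxisPair.apply_le_on_segment (hn : NearAxisPair e c k σ xt yt) (hσ : 0 < σ)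
    (hk : k ≤ 1 / 20) (hκ : 2 * k ≤ κ) (ha : 0 < a)
    (hS : SaddleSlopes f c e a κ θ) (hseg : segment ℝ xt c ⊆ Metric.ball c θ) :
    ∀ p ∈ segment ℝ xt c, f p ≤ f c := by
  intro p hp
  have hpb := hseg hp
  obtain ⟨α, β, hα, hβ, hαβ, rfl⟩ := hp
  have h1 := hS.cone_le _ hpb (by
    rw [axisCoord_combo e c _ _ hαβ, perpPart_combo e c _ _ hαβ]
    simp only [axisCoord_self, perpPart_self, mul_zero, smul_zero, add_zero]
    rw [norm_smul, abs_mul, Real.norm_eq_abs, mul_left_comm]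
    refine mul_le_mul_of_nonneg_left ?_ (abs_nonneg α)
    have h2 : σ / 2 ≤ axisCoord e c xt := le_trans (by nlinarith) hn.left_ge
    rw [abs_of_pos (by linarith)]
    have h3 := hn.left_perp
    have h4 := hS.κ_pos
    nlinarith)
  have : 0 ≤ a / 4 * axisCoord e c (α • xt + β • c) ^ 2 := by positivity
  linarith

/-- A pass of the algorithm either ends at the saddle or leads to another pair around it. -/
theorem SaddlePair.step (h : SaddlePair f c e a θ x y)
    (hM : SaddleModel f c e a b B η k θ) (hS : SaddleSlopes f c e a κ θ) (hκ : 2 * k ≤ κ)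
    (hst : IsLevelSetStep f (Metric.ball c θ) x y xt yt z x' y') :
    f x' = f z ∧ ((x' = c ∧ y' = c) ∨ SaddlePair f c e a θ x' y') := by
  obtain ⟨σ, hσ, hσθ, hfx⟩ := h.exists_scale hM.a_pos hM.r_pos
  obtain ⟨hcl, hz, hx', hy'⟩ := hst
  have hn := h.nearAxisPair hM hS hσ hσθ hfx hcl
  obtain ⟨hsx, hsy⟩ := h.segment_subset_ball hM hS hcl hz
  have hfx' := hx'.apply_eq (hS.continuousOn.mono hsx)
  have hfy' := hy'.apply_eq (hS.continuousOn.mono hsy)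
  refine ⟨hfx', ?_⟩
  rcases (hz.apply_le_center hM hσ hσθ hσθ hn).eq_or_lt with hfz | hfz
  · left
    obtain rfl := hz.eq_center hM hσ hσθ hn hfz
    exact ⟨hx'.eq_right (hn.apply_le_on_segment hσ hM.k_le hκ hM.a_pos hS hsx),
      hy'.eq_right (hn.swap.apply_le_on_segment hσ hM.k_le hκ hM.a_pos hS.neg hsy)⟩
  · right
    obtain ⟨h1, h2, -⟩ := (h.isClosestPair_iff hM hS).1 hcl
    have hgap := h.gap_le_half hM hS hcl hz
    have hlt := h.lt_center
    have hgt := h.gt_center_sub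
    refine ⟨by rwa [hfx'], by linarith, hfx'.trans hfy'.symm, ?_, ?_⟩
    · rw [hfx']
      exact mem_positivePart_of_isFurthestPoint hM hsx h1.2.2 hfz hx'
    · rw [hfx']
      exact mem_positivePart_of_isFurthestPoint hM.neg hsy h2.2.2 hfz hy'

/-- The distance of the closest points to the saddle is controlled by the gap. -/
theorem SaddlePair.norm_bounds (h : SaddlePair f c e a θ x y)
    (hM : SaddleModel f c e a b B η k θ) (hS : SaddleSlopes f c e a κ θ)
    (hcl : IsClosestPair f (Metric.ball c θ) x y xt yt) :
    (f c - f x ≤ 2 * a * ‖xt - c‖ ^ 2 ∧ a * ‖xt - c‖ ^ 2 ≤ 8 * (f c - f x)) ∧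
      (f c - f x ≤ 2 * a * ‖yt - c‖ ^ 2 ∧ a * ‖yt - c‖ ^ 2 ≤ 8 * (f c - f x)) := by
  obtain ⟨σ, hσ, hσθ, hfx⟩ := h.exists_scale hM.a_pos hM.r_pos
  have hn := h.nearAxisPair hM hS hσ hσθ hfx hcl
  have ha := hM.a_pos
  have key : ∀ u, σ / 2 ≤ ‖u - c‖ → u ∈ Metric.closedBall c (2 * σ) →
      f c - f x ≤ 2 * a * ‖u - c‖ ^ 2 ∧ a * ‖u - c‖ ^ 2 ≤ 8 * (f c - f x) := by
    intro u h1 h2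
    rw [mem_closedBall_iff_norm] at h2
    have h3 : a * (σ / 2) ^ 2 ≤ a * ‖u - c‖ ^ 2 := by gcongr
    have h4 : a * ‖u - c‖ ^ 2 ≤ a * (2 * σ) ^ 2 := by gcongr
    constructor <;> linarith
  exact ⟨key xt (hn.le_norm_left hM.norm_axis hσ hM.k_le)
      (hn.left_mem_closedBall hM.norm_axis hσ hM.k_pos hM.k_le),
    key yt (hn.swap.le_norm_left hM.neg.norm_axis hσ hM.k_le)
      (hn.swap.left_mem_closedBall hM.neg.norm_axis hσ hM.k_pos hM.k_le)⟩

end Step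

/-! ### Complete runs and superlinear convergence -/

section Run

/-- The last bound serves two purposes: with `m = κ` it gives `2 * k ≤ κ`, and with `m = ε` it makes
the contraction factor `192 * k ^ 2` at most `ε`. -/
theorem exists_small_slope {a b m : ℝ} (hb : 0 < b) (hm : 0 < m) :
    ∃ k : ℝ, 0 < k ∧ k ≤ 1 / 20 ∧ 384 * a * k ^ 2 ≤ b ∧ 192 * k ≤ m := by
  have h1 : Tendsto (fun t : ℝ => 384 * a * t ^ 2) (𝓝[>] 0) (𝓝 0) := by
    have : Continuous fun t : ℝ => 384 * a * t ^ 2 := by fun_prop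
    simpa using (this.tendsto 0).mono_left nhdsWithin_le_nhds
  have h2 : Tendsto (fun t : ℝ => 192 * t) (𝓝[>] 0) (𝓝 0) := by
    have : Continuous fun t : ℝ => 192 * t := by fun_prop
    simpa using (this.tendsto 0).mono_left nhdsWithin_le_nhds
  obtain ⟨t, ⟨ht0, ht1⟩, ht2, ht3⟩ := ((Filter.Eventually.and
    (Ioo_mem_nhdsGT (by norm_num : (0 : ℝ) < 1 / 20)) ((h1.eventually
    (eventually_lt_nhds hb)).and (h2.eventually (eventually_lt_nhds hm))))).exists
  exact ⟨t, ht0, ht1.le, ht2.le, ht3.le⟩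

theorem convergesSuperlinearly_of_gap {E : Type*} [NormedAddCommGroup E] {s : ℕ → ℝ} {u : ℕ → E}
    {l : E} {a : ℝ} (ha : 0 < a) (hs : Tendsto s atTop (𝓝 0))
    (hsup : ∀ ε > 0, ∀ᶠ i in atTop, s (i + 1) ≤ ε * s i)
    (hlow : ∀ i, s i ≤ 2 * a * ‖u i - l‖ ^ 2) (hup : ∀ i, a * ‖u i - l‖ ^ 2 ≤ 8 * s i) :
    ConvergesSuperlinearly u l := by
  constructor
  · rw [tendsto_iff_norm_sub_tendsto_zero]
    have h1 : Tendsto (fun i => ‖u i - l‖ ^ 2) atTop (𝓝 0) := by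
      refine squeeze_zero (fun i => sq_nonneg _) (fun i => ?_)
        (by simpa using hs.const_mul (8 / a))
      have := hup i
      rw [div_mul_eq_mul_div, le_div_iff₀ ha]
      linarith
    simpa [Real.sqrt_sq] using h1.sqrt
  · rw [isLittleO_iff]
    intro ε hε
    -- The comparison constants `8` and `2` multiply to `16`, and the square root turns `ε ^ 2` into
    -- `ε`.
    filter_upwards [hsup (ε ^ 2 / 16) (by positivity)] with i hi
    have h1 := hup (i + 1)
    have h2 := hlow i
    have h3 : a * ‖u (i + 1) - l‖ ^ 2 ≤ a * (ε * ‖u i - l‖) ^ 2 := by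
      have := mul_le_mul_of_nonneg_left h2 (by positivity : 0 ≤ ε ^ 2 / 16)
      linarith
    exact (sq_le_sq₀ (norm_nonneg _) (by positivity)).1 (le_of_mul_le_mul_left h3 ha)

theorem convergesSuperlinearly_of_gap_eq {s v : ℕ → ℝ} {l : ℝ} (hs : Tendsto s atTop (𝓝 0))
    (hsup : ∀ ε > 0, ∀ᶠ i in atTop, s (i + 1) ≤ ε * s i) (hs0 : ∀ i, 0 ≤ s i)
    (hv : ∀ i, v i = l - s i) : ConvergesSuperlinearly v l := by
  obtain rfl : v = fun i => l - s i := funext hv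
  refine ⟨by simpa using hs.const_sub l, ?_⟩
  rw [isLittleO_iff]
  intro ε hε
  filter_upwards [hsup ε hε] with i hi
  simpa [abs_of_nonneg, hs0] using hi

variable {n : ℕ} {f : EuclideanSpace ℝ (Fin n) → ℝ}
  {c e x₀ y₀ : EuclideanSpace ℝ (Fin n)} {a b B η k κ θ : ℝ}

theorem SaddlePair.of_reachable (h : SaddlePair f c e a θ x₀ y₀)
    (hM : SaddleModel f c e a b B η k θ) (hS : SaddleSlopes f c e a κ θ) (hκ : 2 * k ≤ κ)
    {x y : EuclideanSpace ℝ (Fin n)} (hr : LevelSetReachable f (Metric.ball c θ) x₀ y₀ x y) :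
    (x = c ∧ y = c) ∨ SaddlePair f c e a θ x y := by
  induction hr with
  | init => exact Or.inr h
  | step _ hne hst ih =>
    rcases ih with ⟨rfl, rfl⟩ | ih
    · exact absurd rfl hne
    · exact (ih.step hM hS hκ hst).2

theorem SaddlePair.exists_run (h : SaddlePair f c e a θ x₀ y₀)
    (hM : SaddleModel f c e a b B η k θ) (hS : SaddleSlopes f c e a κ θ) (hκ : 2 * k ≤ κ) :
    ∃ x y xt yt z : ℕ → EuclideanSpace ℝ (Fin n),
      IsLevelSetRun f (Metric.ball c θ) x₀ y₀ x y xt yt z := by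
  have hex : ∀ x y : EuclideanSpace ℝ (Fin n), ∃ xt yt z x' y' : EuclideanSpace ℝ (Fin n),
      (SaddlePair f c e a θ x y → IsLevelSetStep f (Metric.ball c θ) x y xt yt z x' y') ∧
      (x = y → xt = x ∧ yt = x ∧ z = x ∧ x' = x ∧ y' = x) := by
    intro x y
    by_cases hp : SaddlePair f c e a θ x y
    · obtain ⟨xt, yt, z, x', y', hst⟩ := hp.exists_step hM hS
      exact ⟨xt, yt, z, x', y', fun _ => hst, fun hxy => absurd hxy hp.ne⟩
    -- Off the saddle pairs the value `x` is a default, chosen so that the halting rule holds when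
    -- `x = y`.
    · exact ⟨x, x, x, x, x, fun hp' => absurd hp' hp, fun _ => ⟨rfl, rfl, rfl, rfl, rfl⟩⟩
  choose xt yt z x' y' hst hhalt using hex
  let S : ℕ → EuclideanSpace ℝ (Fin n) × EuclideanSpace ℝ (Fin n) := fun i =>
    Nat.rec (x₀, y₀) (fun _ s => (x' s.1 s.2, y' s.1 s.2)) i
  have hinv : ∀ i, ((S i).1 = c ∧ (S i).2 = c) ∨ SaddlePair f c e a θ (S i).1 (S i).2 := by
    intro i
    induction i with
    | zero => exact Or.inr h
    | succ i ih =>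
      rcases ih with ⟨h1, h2⟩ | ih
      · obtain ⟨-, -, -, h3, h4⟩ := hhalt (S i).1 (S i).2 (h1.trans h2.symm)
        exact Or.inl ⟨h3.trans h1, h4.trans h1⟩
      · exact (ih.step hM hS hκ (hst _ _ ih)).2
  refine ⟨fun i => (S i).1, fun i => (S i).2, fun i => xt (S i).1 (S i).2,
    fun i => yt (S i).1 (S i).2, fun i => z (S i).1 (S i).2, rfl, rfl, ?_, ?_⟩
  · intro i hne
    rcases hinv i with ⟨h1, h2⟩ | hp
    · exact absurd (h1.trans h2.symm) hne
    · exact hst _ _ hp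
  · intro i heq
    exact hhalt _ _ heq

theorem SaddlePair.run (h : SaddlePair f c e a θ x₀ y₀)
    (hM : SaddleModel f c e a b B η k θ) (hS : SaddleSlopes f c e a κ θ) (hκ : 2 * k ≤ κ)
    (hfine : ∀ k, 0 < k → k ≤ 1 / 20 → 384 * a * k ^ 2 ≤ b →
      ∃ η r', SaddleModel f c e a b B η k r')
    {x y xt yt z : ℕ → EuclideanSpace ℝ (Fin n)}
    (hrun : IsLevelSetRun f (Metric.ball c θ) x₀ y₀ x y xt yt z) :
    (∀ i, xt i ∈ Metric.ball c θ ∧ yt i ∈ Metric.ball c θ) ∧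
      ConvergesSuperlinearly (fun i => f (xt i)) (f c) ∧
      ConvergesSuperlinearly (fun i => f (yt i)) (f c) ∧
      ConvergesSuperlinearly xt c ∧ ConvergesSuperlinearly yt c := by
  have ha := hM.a_pos
  have hb := hM.b_pos
  have hinv : ∀ i, (x i = c ∧ y i = c) ∨ SaddlePair f c e a θ (x i) (y i) := by
    intro i
    induction i with
    | zero => rw [hrun.init_left, hrun.init_right]; exact Or.inr h
    | succ i ih =>
      rcases ih with ⟨h1, h2⟩ | ih
      · obtain ⟨-, -, -, h3, h4⟩ := hrun.halt i (h1.trans h2.symm)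
        exact Or.inl ⟨h3.trans h1, h4.trans h1⟩
      · exact (ih.step hM hS hκ (hrun.step i ih.ne)).2
  have hcase : ∀ i, (x i = c ∧ xt i = c ∧ yt i = c ∧ x (i + 1) = c) ∨
      (SaddlePair f c e a θ (x i) (y i) ∧
        IsLevelSetStep f (Metric.ball c θ) (x i) (y i) (xt i) (yt i) (z i)
          (x (i + 1)) (y (i + 1))) := by
    intro i
    rcases hinv i with ⟨h1, h2⟩ | hp
    · obtain ⟨h3, h4, -, h5, -⟩ := hrun.halt i (h1.trans h2.symm)
      exact Or.inl ⟨h1, h3.trans h1, h4.trans h1, h5.trans h1⟩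
    · exact Or.inr ⟨hp, hrun.step i hp.ne⟩
  -- All four convergence claims are derived from this gap, which is zero once the run has stopped
  -- at `c`.
  set s : ℕ → ℝ := fun i => f c - f (x i) with hs
  have hs0 : ∀ i, 0 ≤ s i := by
    intro i
    rcases hinv i with ⟨h1, -⟩ | hp
    · simp [hs, h1]
    · exact sub_nonneg.2 hp.lt_center.le
  have hhalf : ∀ i, s (i + 1) ≤ s i / 2 := by
    intro i
    rcases hcase i with ⟨h1, -, -, h2⟩ | ⟨hp, hst⟩
    · simp [hs, h1, h2]
    · have := hp.gap_le_half hM hS hst.closest hst.bisector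
      simpa [hs, (hp.step hM hS hκ hst).1] using this
  have hgeo : ∀ i, s i ≤ s 0 * (1 / 2) ^ i := by
    intro i
    induction i with
    | zero => simp
    | succ i ih =>
      have := hhalf i
      rw [pow_succ]
      linarith
  have hst0 : Tendsto s atTop (𝓝 0) :=
    squeeze_zero hs0 hgeo (by
      simpa using (tendsto_pow_atTop_nhds_zero_of_lt_one (r := (1 / 2 : ℝ)) (by norm_num)
        (by norm_num)).const_mul (s 0))
  have hsup : ∀ ε > 0, ∀ᶠ i in atTop, s (i + 1) ≤ ε * s i := by
    intro ε hε
    -- For each `ε` a finer model is used; it applies as soon as the gap is small compared with its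
    -- radius.
    obtain ⟨k', hk', hk1, hkb, hkm⟩ := exists_small_slope (a := a) hb hε
    have hkε : 192 * k' ^ 2 ≤ ε := by nlinarith
    obtain ⟨η', r', hM'⟩ := hfine k' hk' hk1 hkb
    have hr' : 0 < a * r' ^ 2 / 8 := by have := hM'.r_pos; positivity
    filter_upwards [hst0.eventually (eventually_lt_nhds hr')] with i hi
    rcases hcase i with ⟨h1, -, -, h2⟩ | ⟨hp, hst⟩
    · simp [hs, h1, h2]
    · have := hp.gap_le hM hS hst.closest hst.bisector hM' (by
        simp only [hs] at hi
        linarith)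
      have h3 : s (i + 1) ≤ 192 * k' ^ 2 * s i := by
        simpa [hs, (hp.step hM hS hκ hst).1] using this
      exact h3.trans (mul_le_mul_of_nonneg_right hkε (hs0 i))
  have hvals : ∀ i, f (xt i) = f c - s i ∧ f (yt i) = f c - s i := by
    intro i
    rcases hcase i with ⟨h1, h2, h3, -⟩ | ⟨hp, hst⟩
    · simp [hs, h1, h2, h3]
    · obtain ⟨h1, h2⟩ := hp.apply_closest hM hS hst.closest
      simp [hs, h1, h2]
  have hnorm : ∀ i, (s i ≤ 2 * a * ‖xt i - c‖ ^ 2 ∧ a * ‖xt i - c‖ ^ 2 ≤ 8 * s i) ∧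
      (s i ≤ 2 * a * ‖yt i - c‖ ^ 2 ∧ a * ‖yt i - c‖ ^ 2 ≤ 8 * s i) := by
    intro i
    rcases hcase i with ⟨h1, h2, h3, -⟩ | ⟨hp, hst⟩
    · simp [hs, h1, h2, h3]
    · exact hp.norm_bounds hM hS hst.closest
  refine ⟨fun i => ?_, convergesSuperlinearly_of_gap_eq hst0 hsup hs0 fun i => (hvals i).1,
    convergesSuperlinearly_of_gap_eq hst0 hsup hs0 fun i => (hvals i).2,
    convergesSuperlinearly_of_gap ha hst0 hsup (fun i => (hnorm i).1.1) fun i => (hnorm i).1.2,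
    convergesSuperlinearly_of_gap ha hst0 hsup (fun i => (hnorm i).2.1) fun i => (hnorm i).2.2⟩
  rcases hcase i with ⟨-, h2, h3, -⟩ | ⟨hp, hst⟩
  · rw [h2, h3]
    exact ⟨Metric.mem_ball_self hM.r_pos, Metric.mem_ball_self hM.r_pos⟩
  · obtain ⟨h1, h2, -⟩ := (hp.isClosestPair_iff hM hS).1 hst.closest
    exact ⟨h1.1, h2.1⟩

/-- Points at the same level in different components lie on different sides of the saddle. -/
theorem saddlePair_or_neg (hM : SaddleModel f c e a b B η k θ) (hS : SaddleSlopes f c e a κ θ)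
    (hx : x₀ ∈ Metric.ball c θ) (hy : y₀ ∈ Metric.ball c θ) (hxy : f x₀ = f y₀)
    (hlt : f x₀ < f c) (hgt : f c - a * θ ^ 2 / 16 < f x₀)
    (hne : pathComponentIn (levelSetIn f (Metric.ball c θ) (f x₀)) x₀ ≠
      pathComponentIn (levelSetIn f (Metric.ball c θ) (f x₀)) y₀) :
    SaddlePair f c e a θ x₀ y₀ ∨ SaddlePair f c (-e) a θ x₀ y₀ := by
  have hcomp : ∀ e', SaddleModel f c e' a b B η k θ → SaddleSlopes f c e' a κ θ →
      x₀ ∈ positivePart f c e' θ (f x₀) → y₀ ∉ positivePart f c e' θ (f x₀) := by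
    intro e' hM' hS' h1 h2
    apply hne
    rw [pathComponentIn_eq_positivePart hM' hS' hM.r_pos le_rfl hgt.le hlt h1,
      pathComponentIn_eq_positivePart hM' hS' hM.r_pos le_rfl hgt.le hlt h2]
  have hside : ∀ p ∈ Metric.ball c θ, f p = f x₀ →
      p ∈ positivePart f c e θ (f x₀) ∨ p ∈ positivePart f c (-e) θ (f x₀) := by
    intro p hp hfp
    rw [mem_positivePart_neg]
    rcases (hM.axisCoord_ne_zero hp (hfp.trans_lt hlt)).lt_or_gt with h0 | h0
    · exact Or.inr ⟨hp, hfp.le, h0⟩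
    · exact Or.inl ⟨hp, hfp.le, h0⟩
  rcases hside x₀ hx rfl with h1 | h1
  · exact Or.inl ⟨hlt, hgt, hxy, h1,
      (hside y₀ hy hxy.symm).resolve_left (hcomp e hM hS h1)⟩
  · refine Or.inr ⟨hlt, hgt, hxy, h1, ?_⟩
    rw [neg_neg]
    exact (hside y₀ hy hxy.symm).resolve_right (hcomp (-e) hM.neg hS.neg h1)

end Run

end

/-! ### The main theorem -/

theorem mainTheorem1 {n : ℕ} (f : EuclideanSpace ℝ (Fin n) → ℝ)
    (xbar : EuclideanSpace ℝ (Fin n)) (hf : ContDiffAt ℝ 2 f xbar)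
    (hcrit : IsNondegenerateCriticalPoint f xbar) (hindex : HasMorseIndex f xbar 1) :
    ∃ θ₀ : ℝ, 0 < θ₀ ∧ ∀ θ : ℝ, 0 < θ → θ ≤ θ₀ →
      ∃ ε : ℝ, 0 < ε ∧ ∀ x₀ y₀ : EuclideanSpace ℝ (Fin n),
        x₀ ∈ Metric.ball xbar θ → y₀ ∈ Metric.ball xbar θ →
        f x₀ = f y₀ → f x₀ < f xbar → f xbar - ε < f x₀ →
        pathComponentIn (levelSetIn f (Metric.ball xbar θ) (f x₀)) x₀ ≠
          pathComponentIn (levelSetIn f (Metric.ball xbar θ) (f x₀)) y₀ →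
        (∀ x y : EuclideanSpace ℝ (Fin n),
          LevelSetReachable f (Metric.ball xbar θ) x₀ y₀ x y → x ≠ y →
          ∃ xt yt z x' y' : EuclideanSpace ℝ (Fin n),
            IsLevelSetStep f (Metric.ball xbar θ) x y xt yt z x' y') ∧
        (∃ x y xt yt z : ℕ → EuclideanSpace ℝ (Fin n),
          IsLevelSetRun f (Metric.ball xbar θ) x₀ y₀ x y xt yt z) ∧
        (∀ x y xt yt z : ℕ → EuclideanSpace ℝ (Fin n),
          IsLevelSetRun f (Metric.ball xbar θ) x₀ y₀ x y xt yt z →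
          (∀ i, xt i ∈ Metric.ball xbar θ ∧ yt i ∈ Metric.ball xbar θ) ∧
          ConvergesSuperlinearly (fun i => f (xt i)) (f xbar) ∧
          ConvergesSuperlinearly (fun i => f (yt i)) (f xbar) ∧
          ConvergesSuperlinearly xt xbar ∧
          ConvergesSuperlinearly yt xbar) := by
  obtain ⟨e, a, b, B, κ, r, ha, hb, hr, hS, hfine⟩ := exists_saddleModel hf hcrit hindex
  obtain ⟨k, hk, hk1, hkb, hkm⟩ := exists_small_slope (a := a) hb hS.κ_pos
  have hkκ : 2 * k ≤ κ := by linarith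
  obtain ⟨η, r₁, hM⟩ := hfine k hk hk1 hkb
  -- The gap `a * θ ^ 2 / 16` keeps the level above the values of `f` in the cone beyond height `θ /
  -- 2`, as connectedness of the sides requires.
  refine ⟨min r r₁, lt_min hr hM.r_pos, fun θ hθ hθr => ⟨a * θ ^ 2 / 16, by positivity, ?_⟩⟩
  have hMθ := hM.mono hθ (hθr.trans (min_le_right _ _))
  have hSθ := hS.mono (hθr.trans (min_le_left _ _))
  intro x₀ y₀ hx hy hxy hlt hgt hne
  -- The axis is oriented so that `x₀` lies on its positive side.
  obtain ⟨e', hM', hS', hfine', hp⟩ : ∃ e', SaddleModel f xbar e' a b B η k θ ∧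
      SaddleSlopes f xbar e' a κ θ ∧ (∀ k, 0 < k → k ≤ 1 / 20 → 384 * a * k ^ 2 ≤ b →
        ∃ η r', SaddleModel f xbar e' a b B η k r') ∧ SaddlePair f xbar e' a θ x₀ y₀ := by
    rcases saddlePair_or_neg hMθ hSθ hx hy hxy hlt hgt hne with hp | hp
    · exact ⟨e, hMθ, hSθ, hfine, hp⟩
    · refine ⟨-e, hMθ.neg, hSθ.neg, fun k' h1 h2 h3 => ?_, hp⟩
      obtain ⟨η', r', hM'⟩ := hfine k' h1 h2 h3
      exact ⟨η', r', hM'.neg⟩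
  refine ⟨fun x y hreach hxy' => ?_, hp.exists_run hM' hS' hkκ,
    fun x y xt yt z hrun => hp.run hM' hS' hkκ hfine' hrun⟩
  rcases hp.of_reachable hM' hS' hkκ hreach with ⟨rfl, rfl⟩ | hp'
  · exact absurd rfl hxy'
  · exact hp'.exists_step hM' hS'
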